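/- Let $M$ be a smooth ($C^\infty$) paracompact Hausdorff manifold, let $n\ge 1$, and let $\omega\in\Omega^{n+1}(M)$ be a closed form. Let $\mathfrak g$ be a real Lie algebra acting on $M$, i.e. let $\mathfrak g\to\mathfrak X(M)$, $\xi\mapsto\underline\xi$, be a homomorphism of Lie algebras; write $\iota_\xi=\iota_{\underline\xi}$ and $\mathcal L_\xi=\mathcal L_{\underline\xi}$. Let $N\subset M$ be an arbitrary subset. *Vanishing and reducibility.* Let $I_N\subset C^\infty(M)$ be the ideal of functions vanishing on $N$. A vector field $u$ is *tangent to $N$* if $u\,I_N\subset I_N$; put $I_{\mathfrak X}(N)=\{u\in\mathfrak X(M): u\,C^\infty(M)\subset I_N\}$. Let $I_\Omega(N)\subset\Omega(M)$ be the differential ideal generated by all $\alpha\in\Omega^k(M)$, $k\ge0$, with $\alpha(u_1,\dots,u_k)\in I_N$ whenever $u_1,\dots,u_k$ are tangent to $N$. Let $\mathfrak X_{\mathfrak g}(M)$ be the $C^\infty(M)$-submodule of $\mathfrak X(M)$ generated by the $\underline\xi$, $\xi\in\mathfrak g$. The action is *tangent to $N$* if every $\underline\xi$ is. A form $\alpha$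 is *reducible* if $\mathcal L_\xi\alpha\in I_\Omega(N)$ and $\iota_\xi\alpha\in I_\Omega(N)$ for all $\xi\in\mathfrak g$. A vector field $v$ is *reducible* if it is tangent to $N$ and $[v,\underline\xi]\in\mathfrak X_{\mathfrak g}(M)+I_{\mathfrak X}(N)$ for all $\xi\in\mathfrak g$. *Observables.* The $L_\infty$-algebra $\mathsf{Ham}_\infty(M,\omega)$ has the underlying graded vector space with $\mathsf{Ham}^0=\{(v,\alpha)\in\mathfrak X(M)\oplus\Omega^{n-1}(M): d\alpha=-\iota_v\omega\}$, $\mathsf{Ham}^i=\Omega^{n-1+i}(M)$ for $1-n\le i\le -1$, and $\mathsf{Ham}^i=0$ otherwise. Its multibrackets are the multilinear maps with $$\tilde l_1(\alpha)=\begin{cases}0&|\alpha|=0,\\(0,d\alpha)&|\alpha|=-1,\\ d\alpha&|\alpha|<-1,\end{cases}\qquad \tilde l_2\big((v_1,\alpha_1),(v_2,\alpha_2)\big)=\big([v_1,v_2],\ \varsigma(2)\,\iota_{v_2}\iota_{v_1}\omega\big),$$ $$\tilde l_k\big((v_1,\alpha_1),\dots,(v_k,\alpha_k)\big)=\varsigma(k)\,\iota_{v_k}\cdots\iota_{v_1}\omega\qquad(3\le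 k\le n+1),$$ where $\varsigma(k)=-(-1)^{k(k+1)/2}$; for $k\ge2$, $\tilde l_k$ vanishes if an argument has negative degree, and $\tilde l_k=0$ for $k>n+1$. Here an $L_\infty$-algebra is a $\mathbb Z$-graded real vector space with graded skew-symmetric multilinear maps $l_k$ of degree $2-k$, $k\ge1$, such that for every $m\ge1$ and all homogeneous $x_1,\dots,x_m$ $$\sum_{i+j=m+1}\ \sum_{\sigma}\chi(\sigma)(-1)^{i(j-1)}\,l_j\big(l_i(x_{\sigma(1)},\dots,x_{\sigma(i)}),x_{\sigma(i+1)},\dots,x_{\sigma(m)}\big)=0,$$ where $i,j\ge1$, $\sigma$ runs over the $(i,m-i)$-unshuffles, and $\chi(\sigma)$ is the sign of $\sigma$ times the Koszul sign. An $L_\infty$-subalgebra of it is a graded subspace $V$ such that $V$, with the restricted multibrackets, is an $L_\infty$-algebra and the inclusion is a strict $L_\infty$-morphism. Let $\mathsf{Ham}_\infty(M,\omega)_{[N]}\subset\mathsf{Ham}_\infty(M,\omega)$ be the graded subspace of *reducible observables*: in degree $0$ the pairs $(v,\alpha)\in\mathsf{Ham}^0$ with $v$ a reducible vector field and $\alpha$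 a reducible form, and in negative degrees the reducible forms. **Lemma.** Assume that the action of $\mathfrak g$ on $M$ is tangent to $N$ and that $\omega$ is a reducible form. Then $\mathsf{Ham}_\infty(M,\omega)_{[N]}$ is closed under all the multibrackets $\tilde l_k$, $k\ge1$, and it is an $L_\infty$-subalgebra of $\mathsf{Ham}_\infty(M,\omega)$. -/

import Mathlib

open scoped Manifold ContDiff

set_option linter.unusedSectionVars false

namespace Multisymplectic

noncomputable section

open Bundle VectorField Set ContinuousAlternatingMap
open scoped Topology

section
variable {E : Type*} [NormedAddCommGroup E] [NormedSpace ℝ E] {k : ℕ}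

lemma contDiff_pullback [FiniteDimensional ℝ E] {X : Type*} [NormedAddCommGroup X]
    [NormedSpace ℝ X] : ∀ {k : ℕ} {f : X → E [⋀^Fin k]→L[ℝ] ℝ} {g : X → E →L[ℝ] E},
    ContDiff ℝ ∞ f → ContDiff ℝ ∞ g → ContDiff ℝ ∞ fun x => (f x).compContinuousLinearMap (g x)
  | 0, f, g, hf, _ => by
    convert hf using 2 with x
    ext v
    simp only [compContinuousLinearMap_apply]
    congr 1; exact Subsingleton.elim _ _
  | k + 1, f, g, hf, hg => by
    let T : X → E →L[ℝ] E [⋀^Fin k]→L[ℝ] ℝ :=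
      fun x => ((f x).compContinuousLinearMap (g x)).curryLeft
    have hT : ContDiff ℝ ∞ T := by
      rw [contDiff_clm_apply_iff]
      intro v
      have h1 : ContDiff ℝ ∞ fun x => (f x).curryLeft (g x v) :=
        ((curryLeftLI (𝕜 := ℝ) (E := E) (F := ℝ) (n := k)).contDiff.comp hf).clm_apply
          (hg.clm_apply contDiff_const)
      convert contDiff_pullback h1 hg using 2 with x
      simp [T]
    have h2 : (fun x => (f x).compContinuousLinearMap (g x)) =
        fun x => ((k : ℝ) + 1)⁻¹ • alternatizeUncurryFinCLM ℝ E ℝ (T x) := by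
      funext x
      have hk : ((k : ℝ) + 1) ≠ 0 := by positivity
      have h3 := alternatizeUncurryFin_curryLeft ((f x).compContinuousLinearMap (g x))
      rw [eq_inv_smul_iff₀ hk, alternatizeUncurryFinCLM_apply]
      ext v
      simp [T]
    rw [h2]
    exact (contDiff_const (𝕜 := ℝ) (c := ((k : ℝ) + 1)⁻¹)).smul
      (ContDiff.clm_apply (f := fun _ => alternatizeUncurryFinCLM ℝ E ℝ) contDiff_const hT)

lemma contDiffAt_pullback [FiniteDimensional ℝ E] {f : E → E [⋀^Fin k]→L[ℝ] ℝ}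
    {g : E → E →L[ℝ] E} {y : E} (hf : ContDiffAt ℝ ∞ f y) (hg : ContDiffAt ℝ ∞ g y) :
    ContDiffAt ℝ ∞ (fun z => (f z).compContinuousLinearMap (g z)) y :=
  (contDiff_pullback (X := (E [⋀^Fin k]→L[ℝ] ℝ) × (E →L[ℝ] E)) contDiff_fst
    contDiff_snd).contDiffAt.comp y (hf.prodMk hg)

lemma alternatize_cons (f : E →L[ℝ] E [⋀^Fin (k+1)]→L[ℝ] ℝ) (v : E) :
    (alternatizeUncurryFin f).curryLeft v = f v -
      alternatizeUncurryFin
       (((ContinuousLinearMap.apply ℝ _ v) ∘L (curryLeftLI (𝕜 := ℝ) (E := E) (F := ℝ) (n := k)).toContinuousLinearMap) ∘L f) := by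
  ext w
  simp only [curryLeft_apply_apply, alternatizeUncurryFin_apply, Fin.sum_univ_succ (n := k + 1), ContinuousAlternatingMap.sub_apply]
  simp [Matrix.vecCons, sub_eq_add_neg, ← Finset.sum_neg_distrib, pow_succ]
  congr 1
  funext i
  congr 3
  funext j
  refine Fin.cases ?_ (fun j => ?_) j <;> simp [Fin.removeNth]
end
section Forms
variable {E : Type*} [NormedAddCommGroup E] [NormedSpace ℝ E]
  {M : Type*} [TopologicalSpace M] [ChartedSpace E M] [IsManifold 𝓘(ℝ, E) ∞ M]

/-- The smooth vector fields on `M`. -/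
abbrev VF (E : Type*) [NormedAddCommGroup E] [NormedSpace ℝ E] (M : Type*)
    [TopologicalSpace M] [ChartedSpace E M] [IsManifold 𝓘(ℝ, E) ∞ M] : Type _ :=
  Cₛ^∞⟮𝓘(ℝ, E); E, (TangentSpace 𝓘(ℝ, E) : M → Type _)⟯

/-- The smooth differential `k`-forms on `M`: the smooth sections of the bundle of alternating
`k`-linear forms on the tangent spaces. -/
abbrev Form (E : Type*) [NormedAddCommGroup E] [NormedSpace ℝ E] (M : Type*)
    [TopologicalSpace M] [ChartedSpace E M] [IsManifold 𝓘(ℝ, E) ∞ M] (k : ℕ) : Type _ :=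
  Cₛ^∞⟮𝓘(ℝ, E); E [⋀^Fin k]→L[ℝ] ℝ,
    fun x : M => TangentSpace 𝓘(ℝ, E) x [⋀^Fin k]→L[ℝ] Bundle.Trivial M ℝ x⟯

variable {k : ℕ}

/-- An alternating form `a` on the tangent space at `x` (which Mathlib identifies with `E` through the
preferred chart at `x`) in the coordinates of the chart at `x₀`. -/
def coordAt (x₀ x : M) (a : E [⋀^Fin k]→L[ℝ] ℝ) : E [⋀^Fin k]→L[ℝ] ℝ :=
  ContinuousAlternatingMap.compContinuousLinearMap a (tangentCoordChange 𝓘(ℝ, E) x₀ x x)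

/-- The value of a form at `x`, as an alternating form on `E = T_x M`. -/
def Form.val (α : Form E M k) (x : M) : E [⋀^Fin k]→L[ℝ] ℝ := α x

/-- The value of a vector field at `x`, as an element of `E = T_x M`. -/
def VF.val (v : VF E M) (x : M) : E := v x

/-- A form, read in the chart at `x₀` as a form on an open subset of `E`. -/
def inChart (x₀ : M) (a : M → E [⋀^Fin k]→L[ℝ] ℝ) (y : E) : E [⋀^Fin k]→L[ℝ] ℝ :=
  coordAt x₀ ((extChartAt 𝓘(ℝ, E) x₀).symm y) (a ((extChartAt 𝓘(ℝ, E) x₀).symm y))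

lemma contMDiffAt_iff_inChart {F : Type*} [NormedAddCommGroup F] [NormedSpace ℝ F]
    (f : M → F) (x₀ : M) :
    ContMDiffAt 𝓘(ℝ, E) 𝓘(ℝ, F) ∞ f x₀ ↔
      ContDiffAt ℝ ∞ (f ∘ (extChartAt 𝓘(ℝ, E) x₀).symm) (extChartAt 𝓘(ℝ, E) x₀ x₀) := by
  constructor
  · intro h
    have h2 := (contMDiffWithinAt_extChartAt_symm_target (I := 𝓘(ℝ, E)) (n := ∞) x₀
      (mem_extChartAt_target x₀)).contMDiffAt (extChartAt_target_mem_nhds x₀)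
    have : ContMDiffAt 𝓘(ℝ, E) 𝓘(ℝ, F) ∞ (f ∘ (extChartAt 𝓘(ℝ, E) x₀).symm) (extChartAt 𝓘(ℝ, E) x₀ x₀) := by
      refine ContMDiffAt.comp _ ?_ h2
      rwa [extChartAt_to_inv]
    exact this.contDiffAt
  · intro h
    have : ContMDiffAt 𝓘(ℝ, E) 𝓘(ℝ, F) ∞ ((f ∘ (extChartAt 𝓘(ℝ, E) x₀).symm) ∘ extChartAt 𝓘(ℝ, E) x₀) x₀ :=
      ContMDiffAt.comp _ h.contMDiffAt contMDiffAt_extChartAt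
    refine this.congr_of_eventuallyEq ?_
    filter_upwards [extChartAt_source_mem_nhds (I := 𝓘(ℝ, E)) x₀] with x hx
    exact congrArg f ((extChartAt 𝓘(ℝ, E) x₀).left_inv hx).symm

lemma inCoordinates_eq {x₀ x : M} (hx : x ∈ (chartAt E x₀).source) (a : E [⋀^Fin k]→L[ℝ] ℝ) :
   ContinuousAlternatingMap.inCoordinates (E₁ := (TangentSpace 𝓘(ℝ, E) : M → Type _))
     (E₂ := Bundle.Trivial M ℝ) E ℝ x₀ x x₀ x a = coordAt x₀ x a := by
  ext v
  unfold ContinuousAlternatingMap.inCoordinates coordAt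
  rw [TangentBundle.symmL_trivializationAt_eq_core hx]
  simp
  rfl

/-- The alternating `k`-linear forms on the tangent space at `x`. -/
abbrev FormFiber (E : Type*) [NormedAddCommGroup E] [NormedSpace ℝ E]
  {M : Type*} [TopologicalSpace M] [ChartedSpace E M] [IsManifold 𝓘(ℝ, E) ∞ M] (k : ℕ) (x : M) : Type _ :=
  TangentSpace 𝓘(ℝ, E) x [⋀^Fin k]→L[ℝ] Bundle.Trivial M ℝ x

lemma form_smooth_iff (a : ∀ x : M, FormFiber E k x) (x₀ : M) :
  ContMDiffAt 𝓘(ℝ, E) (𝓘(ℝ, E).prod 𝓘(ℝ, E [⋀^Fin k]→L[ℝ] ℝ)) ∞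
   (fun x => TotalSpace.mk' (E [⋀^Fin k]→L[ℝ] ℝ) x (a x)) x₀ ↔
   ContDiffAt ℝ ∞ (inChart x₀ a) (extChartAt 𝓘(ℝ, E) x₀ x₀) := by
  refine (contMDiffAt_section x₀).trans ?_
  refine Iff.trans ?_ (contMDiffAt_iff_inChart (fun x => coordAt x₀ x (a x)) x₀)
  apply Filter.EventuallyEq.contMDiffAt_iff
  filter_upwards [(chartAt E x₀).open_source.mem_nhds (mem_chart_source E x₀)] with x hx
  exact inCoordinates_eq hx (a x)

lemma vf_smooth_iff (a : ∀ x : M, TangentSpace 𝓘(ℝ, E) x) (x₀ : M) :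
  ContMDiffAt 𝓘(ℝ, E) (𝓘(ℝ, E).prod 𝓘(ℝ, E)) ∞
   (fun x => TotalSpace.mk' E x (a x)) x₀ ↔
   ContDiffAt ℝ ∞ (fun y => tangentCoordChange 𝓘(ℝ, E) ((extChartAt 𝓘(ℝ, E) x₀).symm y) x₀ ((extChartAt 𝓘(ℝ, E) x₀).symm y) (a ((extChartAt 𝓘(ℝ, E) x₀).symm y))) (extChartAt 𝓘(ℝ, E) x₀ x₀) := by
  refine (contMDiffAt_section x₀).trans ?_
  exact (contMDiffAt_iff_inChart (fun x => tangentCoordChange 𝓘(ℝ, E) x x₀ x (a x)) x₀)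

/-- The transition map from the chart at `x` to the chart at `x₀`. -/
def chartChange (E : Type*) [NormedAddCommGroup E] [NormedSpace ℝ E]
  {M : Type*} [TopologicalSpace M] [ChartedSpace E M] (x x₀ : M) : E → E := extChartAt 𝓘(ℝ, E) x₀ ∘ (extChartAt 𝓘(ℝ, E) x).symm

lemma chartChange_contDiffAt {x x₀ : M} {y : E} (hy : y ∈ (extChartAt 𝓘(ℝ, E) x).target)
    (h : (extChartAt 𝓘(ℝ, E) x).symm y ∈ (extChartAt 𝓘(ℝ, E) x₀).source) :
    ContDiffAt ℝ ∞ (chartChange E x x₀) y := by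
  have := contDiffWithinAt_ext_coord_change (I := 𝓘(ℝ, E)) (n := ∞) x₀ x (y := y)
    (by rw [PartialEquiv.trans_source]; exact ⟨hy, h⟩)
  simpa [chartChange, contDiffWithinAt_univ] using this

lemma chartChange_fderiv {x x₀ : M} {y : E} (hy : y ∈ (extChartAt 𝓘(ℝ, E) x).target) :
    fderiv ℝ (chartChange E x x₀) y = tangentCoordChange 𝓘(ℝ, E) x x₀ ((extChartAt 𝓘(ℝ, E) x).symm y) := by
  rw [tangentCoordChange_def, (extChartAt 𝓘(ℝ, E) x).right_inv hy]
  simp [chartChange]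

lemma inChart_change (a : M → E [⋀^Fin k]→L[ℝ] ℝ) {x x₀ : M} {y : E}
    (hy : y ∈ (extChartAt 𝓘(ℝ, E) x).target)
    (h : (extChartAt 𝓘(ℝ, E) x).symm y ∈ (extChartAt 𝓘(ℝ, E) x₀).source) :
    inChart x a y = (inChart x₀ a (chartChange E x x₀ y)).compContinuousLinearMap
      (fderiv ℝ (chartChange E x x₀) y) := by
  rw [chartChange_fderiv hy]
  have e : (extChartAt 𝓘(ℝ, E) x₀).symm (chartChange E x x₀ y) = (extChartAt 𝓘(ℝ, E) x).symm y :=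
    (extChartAt 𝓘(ℝ, E) x₀).left_inv h
  unfold inChart
  rw [e]
  ext w
  simp only [coordAt, ContinuousAlternatingMap.compContinuousLinearMap_apply]
  congr 1
  funext i
  exact (tangentCoordChange_comp ⟨⟨(extChartAt 𝓘(ℝ, E) x).map_target hy, h⟩, mem_extChartAt_source _⟩).symm

lemma chart_nhds {x x₀ : M} {y : E} (hy : y ∈ (extChartAt 𝓘(ℝ, E) x).target)
    (h : (extChartAt 𝓘(ℝ, E) x).symm y ∈ (extChartAt 𝓘(ℝ, E) x₀).source) :
    ∀ᶠ z in 𝓝 y, z ∈ (extChartAt 𝓘(ℝ, E) x).target ∧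
      (extChartAt 𝓘(ℝ, E) x).symm z ∈ (extChartAt 𝓘(ℝ, E) x₀).source :=
  Filter.Eventually.and (show ∀ᶠ z in 𝓝 y, z ∈ (extChartAt 𝓘(ℝ, E) x).target from
    (isOpen_extChartAt_target x).mem_nhds hy)
    ((continuousAt_extChartAt_symm'' hy).eventually_mem (extChartAt_source_mem_nhds' h))

lemma minSmoothness_two_le : minSmoothness ℝ 2 ≤ (∞ : WithTop ℕ∞) := by
  simp only [minSmoothness_of_isRCLikeNormedField]
  exact WithTop.coe_le_coe.2 le_top

/-- A smooth form from a family of alternating maps that is smooth in the charts. -/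
def Form.ofChart (a : M → E [⋀^Fin k]→L[ℝ] ℝ)
    (h : ∀ x, ContDiffAt ℝ ∞ (inChart x a) (extChartAt 𝓘(ℝ, E) x x)) : Form E M k :=
  ⟨a, fun x => (form_smooth_iff a x).2 (h x)⟩

lemma Form.val_ofChart (a : M → E [⋀^Fin k]→L[ℝ] ℝ)
    (h : ∀ x, ContDiffAt ℝ ∞ (inChart x a) (extChartAt 𝓘(ℝ, E) x x)) :
    (Form.ofChart a h).val = a := rfl

lemma Form.val_injective {α β : Form E M k} (h : α.val = β.val) : α = β :=
  DFunLike.ext _ _ fun x => congrFun h x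

lemma Form.val_add (α β : Form E M k) : (α + β).val = α.val + β.val := rfl
lemma Form.val_smul (c : ℝ) (α : Form E M k) : (c • α).val = c • α.val := rfl
lemma Form.val_neg (α : Form E M k) : (-α).val = -α.val := rfl
lemma Form.val_zero : (0 : Form E M k).val = 0 := rfl

lemma Form.contDiffAt_inChart [FiniteDimensional ℝ E] (α : Form E M k) {x₀ : M} {y : E}
    (hy : y ∈ (extChartAt 𝓘(ℝ, E) x₀).target) : ContDiffAt ℝ ∞ (inChart x₀ α.val) y := by
  set p := (extChartAt 𝓘(ℝ, E) x₀).symm y with hp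
  have hs : (extChartAt 𝓘(ℝ, E) x₀).symm y ∈ (extChartAt 𝓘(ℝ, E) p).source := mem_extChartAt_source _
  have h1 : ContDiffAt ℝ ∞ (inChart p α.val) (chartChange E x₀ p y) :=
    (form_smooth_iff (fun x => α x) p).1 (α.contMDiff p)
  have h2 := chartChange_contDiffAt hy hs
  refine (contDiffAt_pullback (h1.comp y h2) (h2.fderiv_right (m := ∞) (by simp))).congr_of_eventuallyEq ?_
  filter_upwards [chart_nhds hy hs] with z hz
  exact inChart_change _ hz.1 hz.2

/-- The exterior derivative at `x`, computed in the chart at `x`. -/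
def extDerivAt (a : M → E [⋀^Fin k]→L[ℝ] ℝ) (x : M) : E [⋀^Fin (k + 1)]→L[ℝ] ℝ :=
  extDeriv (inChart x a) (extChartAt 𝓘(ℝ, E) x x)

lemma inChart_extDeriv [FiniteDimensional ℝ E] (α : Form E M k) {x₀ : M} {y : E}
    (hy : y ∈ (extChartAt 𝓘(ℝ, E) x₀).target) :
    inChart x₀ (extDerivAt α.val) y = extDeriv (inChart x₀ α.val) y := by
  set p := (extChartAt 𝓘(ℝ, E) x₀).symm y with hp
  have hs : (extChartAt 𝓘(ℝ, E) x₀).symm y ∈ (extChartAt 𝓘(ℝ, E) p).source := mem_extChartAt_source _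
  have h2 := chartChange_contDiffAt hy hs
  have h1 : inChart x₀ α.val =ᶠ[𝓝 y] fun z => (inChart p α.val (chartChange E x₀ p z)).compContinuousLinearMap
      (fderiv ℝ (chartChange E x₀ p) z) := by
    filter_upwards [chart_nhds hy hs] with z hz
    exact inChart_change _ hz.1 hz.2
  have h3 : DifferentiableAt ℝ (inChart p α.val) (chartChange E x₀ p y) :=
    (α.contDiffAt_inChart (mem_extChartAt_target p)).differentiableAt (by simp)
  rw [h1.extDeriv_eq, extDeriv_pullback h3 h2 minSmoothness_two_le]
  rw [chartChange_fderiv hy]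
  rfl

/-- A vector field, read in the chart at `x₀` as a vector field on an open subset of `E`. -/
def vfInChart (x₀ : M) (v : M → E) (y : E) : E :=
  tangentCoordChange 𝓘(ℝ, E) ((extChartAt 𝓘(ℝ, E) x₀).symm y) x₀
    ((extChartAt 𝓘(ℝ, E) x₀).symm y) (v ((extChartAt 𝓘(ℝ, E) x₀).symm y))

lemma mem_source_symm {x₀ : M} {y : E} (hy : y ∈ (extChartAt 𝓘(ℝ, E) x₀).target) :
    (extChartAt 𝓘(ℝ, E) x₀).symm y ∈ (extChartAt 𝓘(ℝ, E) x₀).source :=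
  (extChartAt 𝓘(ℝ, E) x₀).map_target hy

lemma inChart_curryLeft (a : M → E [⋀^Fin (k + 1)]→L[ℝ] ℝ) (v : M → E)
    {x₀ : M} {y : E} (hy : y ∈ (extChartAt 𝓘(ℝ, E) x₀).target) :
    inChart x₀ (fun x => (a x).curryLeft (v x)) y = (inChart x₀ a y).curryLeft (vfInChart x₀ v y) := by
  ext w
  simp only [inChart, coordAt, curryLeft_apply_apply, compContinuousLinearMap_apply, vfInChart]
  refine congrArg (a ((extChartAt 𝓘(ℝ, E) x₀).symm y)) ?_
  funext i
  refine Fin.cases ?_ (fun i => rfl) i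
  exact ((tangentCoordChange_comp ⟨⟨mem_extChartAt_source _, mem_source_symm hy⟩,
      mem_extChartAt_source _⟩).trans (tangentCoordChange_self (mem_extChartAt_source _))).symm

lemma inChart_self (a : M → E [⋀^Fin k]→L[ℝ] ℝ) (x : M) :
    inChart x a (extChartAt 𝓘(ℝ, E) x x) = a x := by
  unfold inChart
  rw [extChartAt_to_inv]
  ext w
  simp only [coordAt, compContinuousLinearMap_apply]
  congr 1
  funext i
  exact tangentCoordChange_self (mem_extChartAt_source _)

lemma vfInChart_self (v : M → E) (x : M) :
    vfInChart x v (extChartAt 𝓘(ℝ, E) x x) = v x := by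
  unfold vfInChart
  rw [extChartAt_to_inv]
  exact tangentCoordChange_self (mem_extChartAt_source _)

lemma target_mem_nhds (x : M) : (extChartAt 𝓘(ℝ, E) x).target ∈ 𝓝 (extChartAt 𝓘(ℝ, E) x x) :=
  extChartAt_target_mem_nhds x

variable [FiniteDimensional ℝ E]

lemma inChart_add (a b : M → E [⋀^Fin k]→L[ℝ] ℝ) (x : M) :
    inChart x (a + b) = inChart x a + inChart x b := rfl

lemma inChart_smul (c : ℝ) (a : M → E [⋀^Fin k]→L[ℝ] ℝ) (x : M) :
    inChart x (c • a) = c • inChart x a := rfl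

lemma Form.differentiableAt_inChart (α : Form E M k) (x : M) :
    DifferentiableAt ℝ (inChart x α.val) (extChartAt 𝓘(ℝ, E) x x) :=
  (α.contDiffAt_inChart (mem_extChartAt_target x)).differentiableAt (by simp)

/-- The exterior derivative of differential forms. -/
def Form.d : Form E M k →ₗ[ℝ] Form E M (k + 1) where
  toFun α := Form.ofChart (extDerivAt α.val) fun x => by
    refine ContDiffAt.congr_of_eventuallyEq
      (ContDiffAt.clm_apply (f := fun _ => alternatizeUncurryFinCLM ℝ E ℝ) contDiffAt_const
        ((α.contDiffAt_inChart (mem_extChartAt_target x)).fderiv_right (m := ∞) (by simp))) ?_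
    filter_upwards [target_mem_nhds x] with y hy
    exact inChart_extDeriv α hy
  map_add' α β := Form.val_injective <| by
    funext x
    simp only [Form.val_ofChart, Form.val_add, extDerivAt, inChart_add]
    exact extDeriv_add (α.differentiableAt_inChart x) (β.differentiableAt_inChart x)
  map_smul' c α := Form.val_injective <| by
    funext x
    simp only [Form.val_ofChart, Form.val_smul, extDerivAt, inChart_smul]
    exact extDeriv_smul c _

lemma Form.d_val (α : Form E M k) (x : M) :
    (Form.d α).val x = extDeriv (inChart x α.val) (extChartAt 𝓘(ℝ, E) x x) := rfl

lemma Form.inChart_d (α : Form E M k) {x₀ : M} {y : E}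
    (hy : y ∈ (extChartAt 𝓘(ℝ, E) x₀).target) :
    inChart x₀ (Form.d α).val y = extDeriv (inChart x₀ α.val) y := inChart_extDeriv α hy

lemma Form.d_d (α : Form E M k) : Form.d (Form.d α) = 0 := by
  refine Form.val_injective ?_
  funext x
  have h : inChart x (Form.d α).val =ᶠ[𝓝 (extChartAt 𝓘(ℝ, E) x x)] extDeriv (inChart x α.val) := by
    filter_upwards [target_mem_nhds x] with y hy
    exact Form.inChart_d α hy
  rw [Form.d_val, h.extDeriv_eq]
  exact extDeriv_extDeriv_apply (α.contDiffAt_inChart (mem_extChartAt_target x)) minSmoothness_two_le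

/-- The interior product `ι_v α = α(v, ·, …, ·)`. -/
def iota : VF E M →ₗ[ℝ] Form E M (k + 1) →ₗ[ℝ] Form E M k :=
  LinearMap.mk₂ ℝ (fun v α => Form.ofChart (fun x => (α.val x).curryLeft (v.val x)) fun x => by
      have h1 := (vf_smooth_iff (fun x => v x) x).1 (v.contMDiff x)
      have h2 := α.contDiffAt_inChart (mem_extChartAt_target x)
      refine ContDiffAt.congr_of_eventuallyEq (ContDiffAt.clm_apply
        ((curryLeftLI (𝕜 := ℝ) (E := E) (F := ℝ) (n := k)).contDiff.contDiffAt.comp _ h2) h1) ?_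
      filter_upwards [target_mem_nhds x] with y hy
      exact inChart_curryLeft α.val v.val hy)
    (fun v w α => Form.val_injective <| funext fun x => map_add (α.val x).curryLeft (v.val x) (w.val x))
    (fun c v α => Form.val_injective <| funext fun x => map_smul (α.val x).curryLeft c (v.val x))
    (fun v α β => rfl)
    (fun c v α => rfl)

lemma iota_val (v : VF E M) (α : Form E M (k + 1)) (x : M) :
    (iota v α).val x = (α.val x).curryLeft (v.val x) := rfl

lemma inChart_iota (v : VF E M) (α : Form E M (k + 1)) {x₀ : M} {y : E}
    (hy : y ∈ (extChartAt 𝓘(ℝ, E) x₀).target) :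
    inChart x₀ (iota v α).val y = (inChart x₀ α.val y).curryLeft (vfInChart x₀ v.val y) :=
  inChart_curryLeft α.val v.val hy

lemma isManifold_top_add_one : IsManifold 𝓘(ℝ, E) (((⊤ : ℕ∞) : WithTop ℕ∞) + 1) M :=
  IsManifold.of_le (n := ∞) (by simp)

lemma isManifold_three : IsManifold 𝓘(ℝ, E) (minSmoothness ℝ 3) M :=
  IsManifold.of_le (n := ∞) (by
    simp only [minSmoothness_of_isRCLikeNormedField]
    exact WithTop.coe_le_coe.2 le_top)

lemma VF.mdiff (v : VF E M) (x : M) : MDiffAt (T% (fun y => v y)) x :=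
  (v.contMDiff x).mdifferentiableAt (by simp)

/-- The Lie bracket of vector fields. -/
instance : Bracket (VF E M) (VF E M) where
  bracket v w := ⟨mlieBracket 𝓘(ℝ, E) v w, fun x => by
    have := FiniteDimensional.complete ℝ E
    have := isManifold_top_add_one (E := E) (M := M)
    have : IsManifold 𝓘(ℝ, E) (minSmoothness ℝ 2) M := IsManifold.of_le minSmoothness_two_le
    exact ContMDiffAt.mlieBracket_vectorField (n := ⊤) (m := ⊤) (v.contMDiff x) (w.contMDiff x)
      (by simp)⟩

lemma VF.bracket_apply (v w : VF E M) (x : M) : ⁅v, w⁆ x = mlieBracket 𝓘(ℝ, E) v w x := rfl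

instance : LieRing (VF E M) where
  add_lie u v w := by
    have := FiniteDimensional.complete ℝ E
    ext x : 1
    exact mlieBracket_add_left (u.mdiff x) (v.mdiff x)
  lie_add u v w := by
    have := FiniteDimensional.complete ℝ E
    ext x : 1
    exact mlieBracket_add_right (v.mdiff x) (w.mdiff x)
  lie_self u := by
    ext x : 1
    exact congrFun (mlieBracket_self (I := 𝓘(ℝ, E)) (V := fun y => u y)) x
  leibniz_lie u v w := by
    have := FiniteDimensional.complete ℝ E
    have := isManifold_three (E := E) (M := M)
    ext x : 1
    have h2 : minSmoothness ℝ 2 ≤ (∞ : WithTop ℕ∞) := minSmoothness_two_le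
    exact leibniz_identity_mlieBracket_apply ((u.contMDiff x).of_le h2) ((v.contMDiff x).of_le h2)
      ((w.contMDiff x).of_le h2)

instance : LieAlgebra ℝ (VF E M) where
  lie_smul c v w := by
    have := FiniteDimensional.complete ℝ E
    ext x : 1
    exact mlieBracket_const_smul_right (w.mdiff x)

lemma VF.contDiffAt_inChart (v : VF E M) (x : M) :
    ContDiffAt ℝ ∞ (vfInChart x v.val) (extChartAt 𝓘(ℝ, E) x x) :=
  (vf_smooth_iff (fun x => v x) x).1 (v.contMDiff x)

lemma VF.bracket_val (v w : VF E M) (x : M) : VF.val ⁅v, w⁆ x =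
    lieBracket ℝ (vfInChart x v.val) (vfInChart x w.val) (extChartAt 𝓘(ℝ, E) x x) := by
  have hinv : ∀ v : VF E M, mpullbackWithin 𝓘(ℝ, E) 𝓘(ℝ, E) (extChartAt 𝓘(ℝ, E) x).symm v
      (range 𝓘(ℝ, E)) =ᶠ[𝓝 (extChartAt 𝓘(ℝ, E) x x)] vfInChart x v.val := by
    intro v
    filter_upwards [target_mem_nhds x] with y hy
    have hs : (extChartAt 𝓘(ℝ, E) x).symm y ∈ (chartAt E x).source := by
      simpa using mem_source_symm hy
    have h1 := TangentBundle.symmL_trivializationAt_eq_core (I := 𝓘(ℝ, E)) hs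
    have h2 := TangentBundle.symmL_trivializationAt (I := 𝓘(ℝ, E)) hs
    rw [(extChartAt 𝓘(ℝ, E) x).right_inv hy] at h2
    rw [mpullbackWithin_apply, ← h2, h1]
    change (tangentCoordChange 𝓘(ℝ, E) x ((extChartAt 𝓘(ℝ, E) x).symm y)
      ((extChartAt 𝓘(ℝ, E) x).symm y)).inverse (v.val _) = vfInChart x v.val y
    rw [ContinuousLinearMap.inverse_eq (g := tangentCoordChange 𝓘(ℝ, E)
      ((extChartAt 𝓘(ℝ, E) x).symm y) x ((extChartAt 𝓘(ℝ, E) x).symm y))]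
    · rfl
    · ext u
      exact (tangentCoordChange_comp ⟨⟨mem_extChartAt_source _, mem_source_symm hy⟩,
        mem_extChartAt_source _⟩).trans (tangentCoordChange_self (mem_extChartAt_source _))
    · ext u
      exact (tangentCoordChange_comp ⟨⟨mem_source_symm hy,  mem_extChartAt_source _⟩,
        mem_source_symm hy⟩).trans (tangentCoordChange_self (mem_source_symm hy))
  have h0 : (mfderiv 𝓘(ℝ, E) 𝓘(ℝ, E) (extChartAt 𝓘(ℝ, E) x) x) =
      ContinuousLinearMap.id ℝ E := by
    have hx := mem_chart_source E x
    have h1 := TangentBundle.continuousLinearMapAt_trivializationAt (I := 𝓘(ℝ, E)) hx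
    have h2 := TangentBundle.continuousLinearMapAt_trivializationAt_eq_core (I := 𝓘(ℝ, E)) hx
    rw [← h1, h2]
    ext u
    exact tangentCoordChange_self (mem_extChartAt_source _)
  change mlieBracketWithin 𝓘(ℝ, E) v w univ x = _
  rw [mlieBracketWithin_apply, h0]
  erw [ContinuousLinearMap.inverse_id]
  simp only [preimage_univ, univ_inter, modelWithCornersSelf_coe, range_id]
  have hv := hinv v
  have hw := hinv w
  simp only [modelWithCornersSelf_coe, range_id] at hv hw
  have e := Filter.EventuallyEq.lieBracket_vectorField_eq (𝕜 := ℝ) (E := E) hv hw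
  have e0 : ∀ A B : E → E, lieBracketWithin ℝ A B univ = lieBracket ℝ A B :=
    fun _ _ => lieBracketWithin_univ
  exact (congrFun (e0 _ _) _).trans e

lemma hasFDerivAt_bilin {X Y Z W : Type*} [NormedAddCommGroup X] [NormedSpace ℝ X]
    [NormedAddCommGroup Y] [NormedSpace ℝ Y] [NormedAddCommGroup Z] [NormedSpace ℝ Z]
    [NormedAddCommGroup W] [NormedSpace ℝ W] {F : X → Y} {V : X → Z} {y : X}
    (L : Y →L[ℝ] Z →L[ℝ] W) (hF : DifferentiableAt ℝ F y) (hV : DifferentiableAt ℝ V y) :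
    HasFDerivAt (fun z => L (F z) (V z)) (L (F y) ∘L fderiv ℝ V y +
      (ContinuousLinearMap.apply ℝ _ (V y) ∘L L) ∘L fderiv ℝ F y) y :=
  (((L.hasFDerivAt (x := F y)).comp y hF.hasFDerivAt).clm_apply hV.hasFDerivAt).congr_fderiv
    (ContinuousLinearMap.ext fun _ => rfl)

lemma hasFDerivAt_contract {j : ℕ} {F : E → E [⋀^Fin (j + 1)]→L[ℝ] ℝ} {V : E → E} {y : E}
    (hF : DifferentiableAt ℝ F y) (hV : DifferentiableAt ℝ V y) :
    HasFDerivAt (fun z => (F z).curryLeft (V z))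
      ((F y).curryLeft ∘L fderiv ℝ V y +
        ((ContinuousLinearMap.apply ℝ _ (V y)) ∘L
          (curryLeftLI (𝕜 := ℝ) (E := E) (F := ℝ) (n := j)).toContinuousLinearMap) ∘L
            fderiv ℝ F y) y := 
  hasFDerivAt_bilin (curryLeftLI (𝕜 := ℝ) (E := E) (F := ℝ) (n := j)).toContinuousLinearMap hF hV

lemma extDeriv_contract {j : ℕ} {F : E → E [⋀^Fin (j + 1)]→L[ℝ] ℝ} {V : E → E} {y : E}
    (hF : DifferentiableAt ℝ F y) (hV : DifferentiableAt ℝ V y) (dF : extDeriv F y = 0) :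
    extDeriv (fun z => (F z).curryLeft (V z)) y =
      fderiv ℝ F y (V y) + alternatizeUncurryFin ((F y).curryLeft ∘L fderiv ℝ V y) := by
  have h := alternatize_cons (fderiv ℝ F y) (V y)
  change (extDeriv F y).curryLeft (V y) = _ at h
  rw [dF] at h
  have h' : (0 : E [⋀^Fin (j + 2)]→L[ℝ] ℝ).curryLeft (V y) = 0 := rfl
  rw [h', eq_comm, sub_eq_zero] at h
  unfold extDeriv
  rw [(hasFDerivAt_contract hF hV).fderiv, alternatizeUncurryFin_add, h]
  exact add_comm _ _

lemma lieBracket_contract {F : E → E [⋀^Fin (k + 2)]→L[ℝ] ℝ} {V W : E → E} {y : E}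
    (hF : DifferentiableAt ℝ F y) (hV : DifferentiableAt ℝ V y) (hW : DifferentiableAt ℝ W y)
    (dF : extDeriv F y = 0) (dFV : extDeriv (fun z => (F z).curryLeft (V z)) y = 0)
    (dFW : extDeriv (fun z => (F z).curryLeft (W z)) y = 0) :
    extDeriv (fun z => ((F z).curryLeft (V z)).curryLeft (W z)) y =
      -(F y).curryLeft (lieBracket ℝ V W y) := by
  have hG := hasFDerivAt_contract hF hV
  rw [extDeriv_contract hG.differentiableAt hW dFV, hG.fderiv]
  rw [extDeriv_contract hF hW dF] at dFW
  have h := alternatize_cons ((F y).curryLeft ∘L fderiv ℝ W y) (V y)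
  have h1 : ((F y).curryLeft (V y)).curryLeft ∘L fderiv ℝ W y =
      -(((ContinuousLinearMap.apply ℝ _ (V y)) ∘L
          (curryLeftLI (𝕜 := ℝ) (E := E) (F := ℝ) (n := k)).toContinuousLinearMap) ∘L
            ((F y).curryLeft ∘L fderiv ℝ W y)) := by
    ext u w
    simp only [ContinuousLinearMap.comp_apply, _root_.neg_apply,
      ContinuousAlternatingMap.neg_apply]
    change F y (Matrix.vecCons (V y) (Matrix.vecCons _ w)) =
      -F y (Matrix.vecCons _ (Matrix.vecCons (V y) w))
    have hs := (F y).toAlternatingMap.map_swap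
      (Matrix.vecCons (fderiv ℝ W y u) (Matrix.vecCons (V y) w)) (i := 0) (j := 1) (by simp)
    refine Eq.trans ?_ hs
    refine congrArg (F y) ?_
    funext i
    refine Fin.cases ?_ (fun i => Fin.cases ?_ (fun i => ?_) i) i
    · simp
    · simp
    · rw [Function.comp, Equiv.swap_apply_of_ne_of_ne (by simp)
        (by simp [Fin.ext_iff])]
      rfl
  have h2 : alternatizeUncurryFin (((F y).curryLeft (V y)).curryLeft ∘L fderiv ℝ W y) =
      (alternatizeUncurryFin ((F y).curryLeft ∘L fderiv ℝ W y)).curryLeft (V y) -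
        (F y).curryLeft (fderiv ℝ W y (V y)) := by
    rw [h1, h, ← alternatizeUncurryFinCLM_apply, map_neg, alternatizeUncurryFinCLM_apply]
    change _ = (F y).curryLeft (fderiv ℝ W y (V y)) - _ - _
    abel
  rw [h2]
  have h3 : alternatizeUncurryFin ((F y).curryLeft ∘L fderiv ℝ W y) = -fderiv ℝ F y (W y) :=
    (neg_eq_of_add_eq_zero_right dFW).symm
  rw [h3]
  change (F y).curryLeft (fderiv ℝ V y (W y)) + (fderiv ℝ F y (W y)).curryLeft (V y) +
    (-(fderiv ℝ F y (W y)).curryLeft (V y) - _) = _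
  rw [lieBracket, map_sub]
  abel

lemma d_iota_iota {Ω : Form E M (k + 2)} {v w : VF E M} (h : Form.d Ω = 0) (hv : Form.d (iota v Ω) = 0)
    (hw : Form.d (iota w Ω) = 0) : Form.d (iota w (iota v Ω)) = -iota ⁅v, w⁆ Ω := by
  refine Form.val_injective ?_
  funext x
  have hx := target_mem_nhds (E := E) x
  have e1 : ∀ u : VF E M, inChart x (iota u Ω).val =ᶠ[𝓝 (extChartAt 𝓘(ℝ, E) x x)]
      fun z => (inChart x Ω.val z).curryLeft (vfInChart x u.val z) := fun u => by
    filter_upwards [hx] with y hy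
    exact inChart_iota u Ω hy
  have e2 : inChart x (iota w (iota v Ω)).val =ᶠ[𝓝 (extChartAt 𝓘(ℝ, E) x x)]
      fun z => ((inChart x Ω.val z).curryLeft (vfInChart x v.val z)).curryLeft
        (vfInChart x w.val z) := by
    filter_upwards [hx] with y hy
    rw [inChart_iota w _ hy, inChart_iota v Ω hy]
  have d0 : ∀ {j : ℕ} {α : Form E M j}, Form.d α = 0 →
      extDeriv (inChart x α.val) (extChartAt 𝓘(ℝ, E) x x) = 0 := fun {j α} hα => by
    rw [← Form.d_val, hα]; rfl
  rw [Form.d_val, e2.extDeriv_eq, lieBracket_contract (Ω.differentiableAt_inChart x)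
    ((v.contDiffAt_inChart x).differentiableAt (by simp))
    ((w.contDiffAt_inChart x).differentiableAt (by simp)) (d0 h)
    ((e1 v).extDeriv_eq ▸ d0 hv) ((e1 w).extDeriv_eq ▸ d0 hw), inChart_self, Form.val_neg,
    Pi.neg_apply, iota_val, VF.bracket_val]

section Wedge

lemma contDiff_alternating_of_apply {X : Type*} [NormedAddCommGroup X] [NormedSpace ℝ X] :
    ∀ {k : ℕ} {f : X → E [⋀^Fin k]→L[ℝ] ℝ}, (∀ v, ContDiff ℝ ∞ fun x => f x v) → ContDiff ℝ ∞ f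
  | 0, f, h => by
    have e : f = fun x => ContinuousAlternatingMap.constOfIsEmptyLIE ℝ E ℝ (Fin 0) (f x 0) := by
      funext x
      ext v
      exact congrArg (f x) (Subsingleton.elim _ _)
    rw [e]
    exact (ContinuousAlternatingMap.constOfIsEmptyLIE ℝ E ℝ (Fin 0)).contDiff.comp (h 0)
  | k + 1, f, h => by
    have hT : ContDiff ℝ ∞ fun x => (f x).curryLeft := by
      rw [contDiff_clm_apply_iff]
      intro v
      exact contDiff_alternating_of_apply fun w => h (Matrix.vecCons v w)
    have h2 : f = fun x => ((k : ℝ) + 1)⁻¹ • alternatizeUncurryFinCLM ℝ E ℝ (f x).curryLeft := by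
      funext x
      have hk : ((k : ℝ) + 1) ≠ 0 := by positivity
      have h3 := alternatizeUncurryFin_curryLeft (f x)
      rw [eq_inv_smul_iff₀ hk, alternatizeUncurryFinCLM_apply]
      ext v
      simp
    rw [h2]
    exact (contDiff_const (𝕜 := ℝ) (c := ((k : ℝ) + 1)⁻¹)).smul
      (ContDiff.clm_apply (f := fun _ => alternatizeUncurryFinCLM ℝ E ℝ) contDiff_const hT)

variable {j : ℕ}

/-- The summand of the wedge product that belongs to a class of shuffles. -/
def wedgeSummand (σ : Equiv.Perm.ModSumCongr (Fin j) (Fin k)) (a : E [⋀^Fin j]→L[ℝ] ℝ)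
    (b : E [⋀^Fin k]→L[ℝ] ℝ) (v : Fin j ⊕ Fin k → E) : ℝ :=
  LinearMap.mul' ℝ ℝ
    (AlternatingMap.domCoprod.summand a.toAlternatingMap b.toAlternatingMap σ v)

lemma wedgeSummand_mk (σ : Equiv.Perm (Fin j ⊕ Fin k)) (a : E [⋀^Fin j]→L[ℝ] ℝ)
    (b : E [⋀^Fin k]→L[ℝ] ℝ) (v : Fin j ⊕ Fin k → E) :
    wedgeSummand (Quotient.mk'' σ) a b v = (Equiv.Perm.sign σ : ℤ) •
      (a (fun i => v (σ (Sum.inl i))) * b (fun i => v (σ (Sum.inr i)))) := by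
  rw [wedgeSummand, AlternatingMap.domCoprod.summand_mk'', _root_.smul_apply, Units.smul_def,
    map_zsmul]
  rfl

lemma wedge_eq_sum (a : E [⋀^Fin j]→L[ℝ] ℝ) (b : E [⋀^Fin k]→L[ℝ] ℝ) (v : Fin (j + k) → E) :
    ((LinearMap.mul' ℝ ℝ).compAlternatingMap
      (a.toAlternatingMap.domCoprod b.toAlternatingMap)).domDomCongr finSumFinEquiv v =
      ∑ σ : Equiv.Perm.ModSumCongr (Fin j) (Fin k), wedgeSummand σ a b (v ∘ finSumFinEquiv) := by
  simp only [wedgeSummand, ← _root_.map_sum]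
  refine congrArg (LinearMap.mul' ℝ ℝ) ?_
  rw [← _root_.sum_apply]
  rfl

/-- The wedge product of alternating forms: the signed sum over the shuffles. -/
def wedgeAt (a : E [⋀^Fin j]→L[ℝ] ℝ) (b : E [⋀^Fin k]→L[ℝ] ℝ) : E [⋀^Fin (j + k)]→L[ℝ] ℝ :=
  { ((LinearMap.mul' ℝ ℝ).compAlternatingMap
      (a.toAlternatingMap.domCoprod b.toAlternatingMap)).domDomCongr finSumFinEquiv with
    cont := by
      have h : Continuous fun v : Fin (j + k) → E =>
          ∑ σ : Equiv.Perm.ModSumCongr (Fin j) (Fin k),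
            wedgeSummand σ a b (v ∘ finSumFinEquiv) := by
        refine continuous_finsetSum _ fun σ _ => ?_
        induction σ using Quotient.inductionOn' with | _ σ
        simp only [wedgeSummand_mk]
        have h1 : Continuous fun v : Fin (j + k) → E =>
          fun i => (v ∘ finSumFinEquiv) (σ (Sum.inl i)) := by simp only [Function.comp]; fun_prop
        have h2 : Continuous fun v : Fin (j + k) → E =>
          fun i => (v ∘ finSumFinEquiv) (σ (Sum.inr i)) := by simp only [Function.comp]; fun_prop
        exact ((a.cont.comp h1).mul (b.cont.comp h2)).const_smul (Equiv.Perm.sign σ : ℤ)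
      exact h.congr fun v => (wedge_eq_sum a b v).symm }

lemma wedgeAt_apply (a : E [⋀^Fin j]→L[ℝ] ℝ) (b : E [⋀^Fin k]→L[ℝ] ℝ) (v : Fin (j + k) → E) :
    wedgeAt a b v =
      ∑ σ : Equiv.Perm.ModSumCongr (Fin j) (Fin k), wedgeSummand σ a b (v ∘ finSumFinEquiv) :=
  wedge_eq_sum a b v

lemma wedgeAt_comp (a : E [⋀^Fin j]→L[ℝ] ℝ) (b : E [⋀^Fin k]→L[ℝ] ℝ) (g : E →L[ℝ] E) :
    (wedgeAt a b).compContinuousLinearMap g =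
      wedgeAt (a.compContinuousLinearMap g) (b.compContinuousLinearMap g) := by
  ext v
  rw [compContinuousLinearMap_apply, wedgeAt_apply, wedgeAt_apply]
  refine Finset.sum_congr rfl fun σ _ => ?_
  induction σ using Quotient.inductionOn' with | _ σ
  simp only [wedgeSummand_mk]
  rfl

lemma contDiff_eval (v : Fin k → E) : ContDiff ℝ ∞ fun a : E [⋀^Fin k]→L[ℝ] ℝ => a v :=
  (ContinuousAlternatingMap.apply ℝ E ℝ v).contDiff

lemma contDiff_wedgeAt :
    ContDiff ℝ ∞ fun p : (E [⋀^Fin j]→L[ℝ] ℝ) × (E [⋀^Fin k]→L[ℝ] ℝ) => wedgeAt p.1 p.2 := by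
  refine contDiff_alternating_of_apply fun v => ?_
  simp only [wedgeAt_apply]
  refine ContDiff.sum fun σ _ => ?_
  induction σ using Quotient.inductionOn' with | _ σ
  simp only [wedgeSummand_mk]
  exact (((contDiff_eval _).comp contDiff_fst).mul ((contDiff_eval _).comp contDiff_snd)).const_smul
    (Equiv.Perm.sign σ : ℤ)

lemma contDiffAt_wedge {f : E → E [⋀^Fin j]→L[ℝ] ℝ} {g : E → E [⋀^Fin k]→L[ℝ] ℝ} {y : E}
    (hf : ContDiffAt ℝ ∞ f y) (hg : ContDiffAt ℝ ∞ g y) :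
    ContDiffAt ℝ ∞ (fun z => wedgeAt (f z) (g z)) y :=
  ContDiffAt.comp (g := fun p : (E [⋀^Fin j]→L[ℝ] ℝ) × (E [⋀^Fin k]→L[ℝ] ℝ) => wedgeAt p.1 p.2)
    (f := fun z => (f z, g z)) y contDiff_wedgeAt.contDiffAt (hf.prodMk hg)

lemma inChart_wedge (a : M → E [⋀^Fin j]→L[ℝ] ℝ) (b : M → E [⋀^Fin k]→L[ℝ] ℝ) (x : M) :
    inChart x (fun z => wedgeAt (a z) (b z)) =
      fun y => wedgeAt (inChart x a y) (inChart x b y) :=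
  funext fun _ => wedgeAt_comp _ _ _

/-- The wedge product of differential forms. -/
def Form.wedge (α : Form E M j) (β : Form E M k) : Form E M (j + k) :=
  Form.ofChart (fun x => wedgeAt (α.val x) (β.val x)) fun x => by
    rw [inChart_wedge]
    exact contDiffAt_wedge (α.contDiffAt_inChart (mem_extChartAt_target x))
      (β.contDiffAt_inChart (mem_extChartAt_target x))

end Wedge


/-- Multiplication of vector fields by smooth functions. -/
instance : SMul C^∞⟮𝓘(ℝ, E), M; ℝ⟯ (VF E M) where
  smul f v := ⟨fun x => f x • v x, f.contMDiff.smul_section v.contMDiff⟩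

instance : Module C^∞⟮𝓘(ℝ, E), M; ℝ⟯ (VF E M) where
  one_smul v := by ext x : 1; exact one_smul ℝ (v x)
  mul_smul f g v := by ext x : 1; exact mul_smul (f x) (g x) (v x)
  smul_zero f := by ext x : 1; exact smul_zero (f x)
  smul_add f v w := by ext x : 1; exact smul_add (f x) (v x) (w x)
  add_smul f g v := by ext x : 1; exact add_smul (f x) (g x) (v x)
  zero_smul v := by ext x : 1; exact zero_smul ℝ (v x)

instance : IsScalarTower ℝ C^∞⟮𝓘(ℝ, E), M; ℝ⟯ (VF E M) where
  smul_assoc c f v := by ext x : 1; exact smul_assoc c (f x) (v x)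

/-- The contraction with `v` as a map of degree `-1`; it is zero on functions. -/
def contract (v : VF E M) : ∀ k, Form E M k →ₗ[ℝ] Form E M (k - 1)
  | 0 => 0
  | _ + 1 => iota v

/-- The Lie derivative along `v`, by Cartan's formula `L_v = d ι_v + ι_v d`. -/
def lieDerivative (v : VF E M) : ∀ k, Form E M k →ₗ[ℝ] Form E M k
  | 0 => iota v ∘ₗ Form.d
  | _ + 1 => Form.d ∘ₗ iota v + iota v ∘ₗ Form.d

/-- The vector fields `u` with `u I_N ⊆ I_N`, where `I_N` is the ideal of the smooth functions that
vanish on `N`. -/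
def tangentFields (N : Set M) : Submodule ℝ (VF E M) where
  carrier := {u | ∀ f : C^∞⟮𝓘(ℝ, E), M; ℝ⟯, (∀ x ∈ N, f x = 0) →
    ∀ x ∈ N, mfderiv 𝓘(ℝ, E) 𝓘(ℝ, ℝ) f x (u x) = 0}
  add_mem' {u v} hu hv f hf x hx := by
    refine ((mfderiv 𝓘(ℝ, E) 𝓘(ℝ, ℝ) f x).map_add (u x) (v x)).trans ?_
    rw [hu f hf x hx, hv f hf x hx, add_zero]
  zero_mem' f _ x _ := (mfderiv 𝓘(ℝ, E) 𝓘(ℝ, ℝ) f x).map_zero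
  smul_mem' c u hu f hf x hx := by
    refine ((mfderiv 𝓘(ℝ, E) 𝓘(ℝ, ℝ) f x).map_smul c (u x)).trans ?_
    rw [hu f hf x hx, smul_zero]

/-- The vector fields `u` with `u C^∞(M) ⊆ I_N`. -/
def vanishingFields (N : Set M) : Submodule ℝ (VF E M) where
  carrier := {u | ∀ f : C^∞⟮𝓘(ℝ, E), M; ℝ⟯,
    ∀ x ∈ N, mfderiv 𝓘(ℝ, E) 𝓘(ℝ, ℝ) f x (u x) = 0}
  add_mem' {u v} hu hv f x hx := by
    refine ((mfderiv 𝓘(ℝ, E) 𝓘(ℝ, ℝ) f x).map_add (u x) (v x)).trans ?_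
    rw [hu f x hx, hv f x hx, add_zero]
  zero_mem' f x _ := (mfderiv 𝓘(ℝ, E) 𝓘(ℝ, ℝ) f x).map_zero
  smul_mem' c u hu f x hx := by
    refine ((mfderiv 𝓘(ℝ, E) 𝓘(ℝ, ℝ) f x).map_smul c (u x)).trans ?_
    rw [hu f x hx, smul_zero]

/-- A differential ideal of the de Rham algebra, given by its homogeneous components: a graded
subspace that is closed under `d` and under wedge products with arbitrary forms, on either side. -/
structure IsDifferentialIdeal (J : ∀ k, Submodule ℝ (Form E M k)) : Prop where
  d_mem : ∀ {k} {α : Form E M k}, α ∈ J k → Form.d α ∈ J (k + 1)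
  wedge_mem_left : ∀ {j k} {α : Form E M j} (β : Form E M k), α ∈ J j → α.wedge β ∈ J (j + k)
  wedge_mem_right : ∀ {j k} (α : Form E M j) {β : Form E M k}, β ∈ J k → α.wedge β ∈ J (j + k)

/-- The `k`-forms `α` with `α(u₁, …, u_k) ∈ I_N` whenever `u₁, …, u_k` are tangent to `N`. -/
def vanishingGenerators (N : Set M) (k : ℕ) : Set (Form E M k) :=
  {α | ∀ u : Fin k → VF E M, (∀ i, u i ∈ tangentFields N) →
    ∀ x ∈ N, α.val x (fun i => (u i).val x) = 0}

/-- The degree `k` component of the differential ideal that is generated by the forms in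
`vanishingGenerators N`. -/
def vanishingForms (N : Set M) (k : ℕ) : Submodule ℝ (Form E M k) where
  carrier := {α | ∀ J : ∀ j, Submodule ℝ (Form E M j), IsDifferentialIdeal J →
    (∀ j, vanishingGenerators N j ⊆ (J j : Set (Form E M j))) → α ∈ J k}
  add_mem' hα hβ J hJ hN := add_mem (hα J hJ hN) (hβ J hJ hN)
  zero_mem' J _ _ := zero_mem (J k)
  smul_mem' c _ hα J hJ hN := Submodule.smul_mem (J k) c (hα J hJ hN)

section Reducible

variable {𝔤 : Type*} [LieRing 𝔤] [LieAlgebra ℝ 𝔤]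

/-- The infinitesimal action `ρ` of a Lie algebra on `M` is tangent to `N`. -/
def IsTangentAction (ρ : 𝔤 →ₗ⁅ℝ⁆ VF E M) (N : Set M) : Prop :=
  ∀ ξ, ρ ξ ∈ tangentFields N

/-- The `C^∞(M)`-submodule of the vector fields that is generated by the fundamental vector
fields of the action `ρ`. -/
def fundamentalFields (ρ : 𝔤 →ₗ⁅ℝ⁆ VF E M) : Submodule C^∞⟮𝓘(ℝ, E), M; ℝ⟯ (VF E M) :=
  Submodule.span C^∞⟮𝓘(ℝ, E), M; ℝ⟯ (range ρ)

/-- The `k`-forms `α` such that `L_ξ α` and `ι_ξ α` vanish along `N` for all `ξ` in the Lie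
algebra. -/
def reducibleForms (ρ : 𝔤 →ₗ⁅ℝ⁆ VF E M) (N : Set M) (k : ℕ) : Submodule ℝ (Form E M k) where
  carrier := {α | ∀ ξ, lieDerivative (ρ ξ) k α ∈ vanishingForms N k ∧
    contract (ρ ξ) k α ∈ vanishingForms N (k - 1)}
  add_mem' hα hβ ξ := by
    rw [map_add, map_add]
    exact ⟨add_mem (hα ξ).1 (hβ ξ).1, add_mem (hα ξ).2 (hβ ξ).2⟩
  zero_mem' ξ := by
    rw [_root_.map_zero, _root_.map_zero]
    exact ⟨zero_mem _, zero_mem _⟩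
  smul_mem' c α hα ξ := by
    rw [_root_.map_smul, _root_.map_smul]
    exact ⟨Submodule.smul_mem _ c (hα ξ).1, Submodule.smul_mem _ c (hα ξ).2⟩

/-- The vector fields `v` that are tangent to `N` and for which the bracket of `v` with every
fundamental vector field is the sum of an element of `fundamentalFields ρ` and of a vector field
that vanishes along `N`. -/
def reducibleFields (ρ : 𝔤 →ₗ⁅ℝ⁆ VF E M) (N : Set M) : Submodule ℝ (VF E M) where
  carrier := {v | v ∈ tangentFields N ∧
    ∀ ξ, ⁅v, ρ ξ⁆ ∈ (fundamentalFields ρ).restrictScalars ℝ ⊔ vanishingFields N}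
  add_mem' hu hv := ⟨add_mem hu.1 hv.1, fun ξ => by
    rw [add_lie]
    exact add_mem (hu.2 ξ) (hv.2 ξ)⟩
  zero_mem' := ⟨zero_mem _, fun ξ => by
    rw [zero_lie]
    exact zero_mem _⟩
  smul_mem' c v hv := ⟨Submodule.smul_mem _ c hv.1, fun ξ => by
    rw [smul_lie]
    exact Submodule.smul_mem _ c (hv.2 ξ)⟩

end Reducible

section Observables

/-- A pre-`n`-plectic structure on `M`, for `n = m + 1 ≥ 1`: a closed `(n + 1)`-form. -/
structure PrePlectic (E : Type*) [NormedAddCommGroup E] [NormedSpace ℝ E] (M : Type*)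
    [TopologicalSpace M] [ChartedSpace E M] [IsManifold 𝓘(ℝ, E) ∞ M] [FiniteDimensional ℝ E] (m : ℕ) where
  form : Form E M (m + 2)
  closed : Form.d form = 0

variable {m : ℕ}

/-- The pairs `(v, α)` of a vector field and an `(n - 1)`-form with `dα = -ι_v ω`. -/
def hamPairs (Ω : PrePlectic E M m) : Submodule ℝ (VF E M × Form E M m) where
  carrier := {p | Form.d p.2 = -iota p.1 Ω.form}
  add_mem' {p q} hp hq := by
    change Form.d (p.2 + q.2) = -iota (p.1 + q.1) Ω.form
    rw [_root_.map_add, _root_.map_add, LinearMap.add_apply, neg_add, ← hp, ← hq]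
  zero_mem' := by
    change Form.d 0 = -iota 0 Ω.form
    rw [_root_.map_zero, _root_.map_zero, LinearMap.zero_apply, neg_zero]
  smul_mem' c p hp := by
    change Form.d (c • p.2) = -iota (c • p.1) Ω.form
    rw [_root_.map_smul, _root_.map_smul, LinearMap.smul_apply, ← smul_neg, ← hp]

/-- The total space of the graded vector space of observables: the pairs in degree `0`, and the
`k`-forms in degree `k - m = k - (n - 1)` for `0 ≤ k < m`. -/
abbrev Ham (Ω : PrePlectic E M m) : Type _ := hamPairs Ω × (∀ k : Fin m, Form E M k)

/-- The homogeneous elements of degree `i`. -/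
def Ham.degree (Ω : PrePlectic E M m) (i : ℤ) : Submodule ℝ (Ham Ω) where
  carrier := {x | (i ≠ 0 → x.1 = 0) ∧ ∀ k : Fin m, i ≠ (k : ℤ) - m → x.2 k = 0}
  add_mem' {x y} hx hy := ⟨fun h => by
      change x.1 + y.1 = 0
      rw [hx.1 h, hy.1 h, add_zero], fun k h => by
      change x.2 k + y.2 k = 0
      rw [hx.2 k h, hy.2 k h, add_zero]⟩
  zero_mem' := ⟨fun _ => rfl, fun _ _ => rfl⟩
  smul_mem' c x hx := ⟨fun h => by
      change c • x.1 = 0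
      rw [hx.1 h, smul_zero], fun k h => by
      change c • x.2 k = 0
      rw [hx.2 k h]
      exact smul_zero (A := Form E M k) c⟩

/-- The total Koszul sign `ς(k) = -(-1)^{k(k+1)/2}`. -/
def totalSign (k : ℕ) : ℝ := -(-1) ^ (k * (k + 1) / 2)

/-- The iterated contraction `ι(v₁ ∧ ⋯ ∧ v_k) α = ι_{v_k} ⋯ ι_{v₁} α = α(v₁, …, v_k, ·, …, ·)`. -/
def iotas : ∀ (k : ℕ) {p : ℕ}, (Fin k → VF E M) → Form E M (p + k) → Form E M p
  | 0, _, _, α => α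
  | k + 1, _, v, α => iotas k (Fin.tail v) (iota (v 0) α)

/-- The `k`-form that is the exterior derivative of the component of form degree `k - 1`. -/
def Ham.dForm {Ω : PrePlectic E M m} (x : Ham Ω) : ∀ k, Form E M k
  | 0 => 0
  | k + 1 => if h : k < m then Form.d (x.2 ⟨k, h⟩) else 0

lemma Ham.d_dForm {Ω : PrePlectic E M m} (x : Ham Ω) : ∀ k, Form.d (x.dForm k) = 0
  | 0 => _root_.map_zero _
  | k + 1 => by
    by_cases h : k < m
    · rw [Ham.dForm, dif_pos h]
      exact Form.d_d _
    · rw [Ham.dForm, dif_neg h]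
      exact _root_.map_zero _

/-- The unary bracket: `0` in degree `0`, `α ↦ (0, dα)` in degree `-1`, and `α ↦ dα` in the
degrees below. -/
def Ham.bracket₁ {Ω : PrePlectic E M m} (x : Ham Ω) : Ham Ω :=
  (⟨(0, x.dForm m), by
    change Form.d (x.dForm m) = -iota 0 Ω.form
    rw [x.d_dForm, _root_.map_zero, LinearMap.zero_apply, neg_zero]⟩, fun k => x.dForm k)

lemma totalSign_two : totalSign 2 = 1 := by norm_num [totalSign]

/-- The binary bracket: `((v₁, α₁), (v₂, α₂)) ↦ ([v₁, v₂], ς(2) ι(v₁ ∧ v₂) ω)` in degree `0`, and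
zero if one of the arguments has negative degree. -/
def Ham.bracket₂ {Ω : PrePlectic E M m} (x y : Ham Ω) : Ham Ω :=
  (⟨(⁅x.1.1.1, y.1.1.1⁆, totalSign 2 • iotas 2 ![x.1.1.1, y.1.1.1] Ω.form), by
    have hd : ∀ p : hamPairs Ω, Form.d (iota p.1.1 Ω.form) = 0 := fun p => by
      have h : Form.d p.1.2 = -iota p.1.1 Ω.form := p.2
      rw [← neg_neg (iota p.1.1 Ω.form), ← h, _root_.map_neg, Form.d_d, neg_zero]
    rw [totalSign_two, one_smul]
    exact d_iota_iota Ω.closed (hd x.1) (hd y.1)⟩, 0)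

/-- The multibrackets of the observables. For `k ≥ 3` the bracket of `k` pairs `(vᵢ, αᵢ)` is
`ς(k) ι(v₁ ∧ ⋯ ∧ v_k) ω`, a form of degree `n + 1 - k`; it is zero if `k > n + 1`, or if one of the
arguments has negative degree. -/
def Ham.bracket (Ω : PrePlectic E M m) : ∀ k, (Fin k → Ham Ω) → Ham Ω
  | 0, _ => 0
  | 1, x => (x 0).bracket₁
  | 2, x => (x 0).bracket₂ (x 1)
  | k + 3, x => (0, fun p => if h : m + 2 = p + (k + 3) then
      totalSign (k + 3) • iotas (k + 3) (fun i => (x i).1.1.1) (h ▸ Ω.form) else 0)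

variable {𝔤 : Type*} [LieRing 𝔤] [LieAlgebra ℝ 𝔤]

/-- The reducible observables: the pairs `(v, α)` of a reducible vector field and a reducible form
in degree `0`, and the reducible forms in negative degrees. -/
def reducibleObservables (Ω : PrePlectic E M m) (ρ : 𝔤 →ₗ⁅ℝ⁆ VF E M) (N : Set M) :
    Submodule ℝ (Ham Ω) where
  carrier := {x | x.1.1.1 ∈ reducibleFields ρ N ∧ x.1.1.2 ∈ reducibleForms ρ N m ∧
    ∀ k : Fin m, x.2 k ∈ reducibleForms ρ N k}
  add_mem' hx hy := ⟨add_mem hx.1 hy.1, add_mem hx.2.1 hy.2.1,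
    fun k => add_mem (hx.2.2 k) (hy.2.2 k)⟩
  zero_mem' := ⟨zero_mem _, zero_mem _, fun _ => zero_mem _⟩
  smul_mem' c _ hx := ⟨Submodule.smul_mem _ c hx.1, Submodule.smul_mem _ c hx.2.1,
    fun k => Submodule.smul_mem _ c (hx.2.2 k)⟩

end Observables

end Forms

section LInfty

variable {L : Type*} [AddCommGroup L] [Module ℝ L]

/-- The antisymmetric Koszul sign `χ(σ; x₁, …, x_k)` of a permutation of elements of degrees
`d₁, …, d_k`: the sign of `σ`, times `(-1)^{d_a d_b}` for every pair that `σ` inverts. -/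
def koszulSign {k : ℕ} (d : Fin k → ℤ) (σ : Equiv.Perm (Fin k)) : ℤˣ :=
  Equiv.Perm.sign σ *
    ∏ p : Fin k × Fin k with p.1 < p.2 ∧ σ p.2 < σ p.1, (d (σ p.1) * d (σ p.2)).negOnePow

/-- The permutations `σ` with `σ(1) < ⋯ < σ(i)` and `σ(i + 1) < ⋯ < σ(k)`. -/
def IsUnshuffle {k : ℕ} (i : ℕ) (σ : Equiv.Perm (Fin k)) : Prop :=
  ∀ a b : Fin k, a < b → ((b : ℕ) < i ∨ i ≤ (a : ℕ)) → σ a < σ b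

instance {k : ℕ} (i : ℕ) : DecidablePred (IsUnshuffle (k := k) i) := fun σ =>
  inferInstanceAs (Decidable (∀ a b : Fin k, a < b → ((b : ℕ) < i ∨ i ≤ (a : ℕ)) → σ a < σ b))

/-- An `L_∞`-algebra structure on the vector space `L`, graded by `𝒜`, with multibrackets `l k` for
`k ≥ 1` (cohomological convention: `l k` has degree `2 - k`). The last field is the higher Jacobi
relation in arity `n + 1`,
`∑_{i + j = n + 2} ∑_σ χ(σ) (-1)^{i (j - 1)} l_j (l_i (x_{σ(1)}, …, x_{σ(i)}), x_{σ(i+1)}, …) = 0`,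
with `σ` running over the `(i, n + 1 - i)`-unshuffles; the index `i` of the code is one less. -/
structure IsLInftyAlgebra (𝒜 : ℤ → Submodule ℝ L) (l : ∀ k, (Fin k → L) → L) : Prop where
  internal : DirectSum.IsInternal 𝒜
  multilinear : ∀ k, 1 ≤ k → ∃ f : MultilinearMap ℝ (fun _ : Fin k => L) L, ∀ x, f x = l k x
  degree : ∀ k, 1 ≤ k → ∀ (d : Fin k → ℤ) (x : Fin k → L), (∀ i, x i ∈ 𝒜 (d i)) →
    l k x ∈ 𝒜 (∑ i, d i + 2 - k)
  skew : ∀ k, 1 ≤ k → ∀ (d : Fin k → ℤ) (x : Fin k → L), (∀ i, x i ∈ 𝒜 (d i)) →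
    ∀ σ : Equiv.Perm (Fin k), l k (x ∘ σ) = koszulSign d σ • l k x
  jacobi : ∀ (n : ℕ) (d : Fin (n + 1) → ℤ) (x : Fin (n + 1) → L), (∀ i, x i ∈ 𝒜 (d i)) →
    ∑ i : Fin (n + 1), ∑ σ : Equiv.Perm (Fin (n + 1)) with IsUnshuffle (i + 1) σ,
      (koszulSign d σ * (-1) ^ ((i + 1) * (n - i) : ℕ)) •
        l (n - i + 1) (Fin.cons
          (l (i + 1) fun a => x (σ ⟨a, by omega⟩))
          fun b => x (σ ⟨i + 1 + b, by omega⟩)) = 0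

/-- `V` is a graded subspace of the `L_∞`-algebra `(L, l)` that is an `L_∞`-algebra with the
restricted multibrackets `μ`, so that the inclusion is a strict `L_∞`-morphism. -/
def IsLInftySubalgebra (𝒜 : ℤ → Submodule ℝ L) (l : ∀ k, (Fin k → L) → L)
    (V : Submodule ℝ L) : Prop :=
  IsLInftyAlgebra 𝒜 l ∧ ∃ μ : ∀ k, (Fin k → V) → V,
    IsLInftyAlgebra (fun i => (𝒜 i).comap V.subtype) μ ∧
      ∀ k, 1 ≤ k → ∀ x : Fin k → V, (μ k x : L) = l k fun i => x i

end LInfty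

end

end Multisymplectic

/-! Two things have to be shown: reducibility survives the multibrackets, and the multibrackets
satisfy the higher Jacobi relations. Both rest on the Cartan calculus, chiefly on `L_u ι_w = ι_w L_u
+ ι_[u,w]` (`lieDerivative_iota`).

Closure. The forms that vanish along `N` on tangent vector fields already form a differential ideal
(`vanishingForms_eq`), so membership in `I_Ω(N)` can be tested by evaluation. The ideal is therefore
stable under `ι_v` for `v` tangent to `N`, and it contains `ι_w α` for every form `α` whenever `w`
vanishes along `N`. If `v` and `α` are reducible, then `L_ξ ι_v α = ι_v L_ξ α + ι_[ξ,v] α` lies in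
it: `[ξ,v]` is a function combination of fundamental fields, whose contractions with `α` lie in the
ideal, plus a field vanishing along `N`. Hence `ι_v α` is reducible (`iota_mem_reducibleForms`), and
so are all multicontractions of `ω`. By the Jacobi identity and the Leibniz rule reducible fields
form a Lie algebra (`lie_mem_reducibleFields`), and `d` preserves reducible forms because it
commutes with `L_ξ` (`d_mem_reducibleForms`).

Higher Jacobi relations. A bracket of arity at least two sees only the vector fields of its
arguments, and only the binary bracket can return a nonzero field. So in arity at least three just
two kinds of terms survive: the unary bracket of the full bracket, and the terms with a binary
bracket inside. What remains is the Jacobi identity for vector fields together with a formula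
expressing `d ι(v₁ ∧ ⋯ ∧ v_k) ω` through the contractions with one bracket `[v_a, v_b]`. The latter
is an iterated Cartan formula for a closed form preserved by all `v_i` (`cartanDefect_zero`,
`cartanDefect_pos`, `dMultiContraction_add_sum`), and the signs `ς(k)` are made to fit it.

Finally, the axioms restrict to any graded subspace closed under the brackets
(`IsLInftyAlgebra.isLInftySubalgebra`). -/

namespace Multisymplectic

noncomputable section

open Bundle VectorField Set ContinuousAlternatingMap
open scoped Topology

/-! ### Cartan calculus: the commutator of Lie derivative and contraction -/

section Cartan

variable {E : Type*} [NormedAddCommGroup E] [NormedSpace ℝ E]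

lemma curryLeft_curryLeft_swap {k : ℕ} (a : E [⋀^Fin (k + 2)]→L[ℝ] ℝ) (u v : E) :
    (a.curryLeft u).curryLeft v = -(a.curryLeft v).curryLeft u := by
  ext w
  change a (Matrix.vecCons u (Matrix.vecCons v w)) = -a (Matrix.vecCons v (Matrix.vecCons u w))
  have hs := a.toAlternatingMap.map_swap (Matrix.vecCons v (Matrix.vecCons u w))
    (i := 0) (j := 1) (by simp)
  refine Eq.trans ?_ hs
  refine congrArg a ?_
  funext i
  refine Fin.cases ?_ (fun i => Fin.cases ?_ (fun i => ?_) i) i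
  · simp
  · simp
  · rw [Function.comp, Equiv.swap_apply_of_ne_of_ne (by simp) (by simp [Fin.ext_iff])]
    rfl

/-- Cartan's formula in flat space. The part of `d(ι_V F)` in which `F` is differentiated in a
direction other than `V` cancels against `ι_V dF`; what is left is the directional derivative along
`V` and a term in `DV`. -/
lemma extDeriv_curryLeft [FiniteDimensional ℝ E] {k : ℕ} {F : E → E [⋀^Fin (k + 1)]→L[ℝ] ℝ}
    {V : E → E} {y : E} (hF : DifferentiableAt ℝ F y) (hV : DifferentiableAt ℝ V y) :
    extDeriv (fun z => (F z).curryLeft (V z)) y + (extDeriv F y).curryLeft (V y) =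
      fderiv ℝ F y (V y) + alternatizeUncurryFin ((F y).curryLeft ∘L fderiv ℝ V y) := by
  have h := alternatize_cons (fderiv ℝ F y) (V y)
  change (extDeriv F y).curryLeft (V y) = _ at h
  rw [h]
  unfold extDeriv
  rw [(hasFDerivAt_contract hF hV).fderiv, alternatizeUncurryFin_add]
  abel

/-- The alternatization is the derivation `∑ a(…, g wᵢ, …)` induced by `g`. Inserting `w` first
separates the summand in which `g` hits `w` from the derivation applied to `a(w, …)`. -/
lemma curryLeft_alternatize_contract {k : ℕ} (a : E [⋀^Fin (k + 2)]→L[ℝ] ℝ) (g : E →L[ℝ] E)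
    (w : E) : (alternatizeUncurryFin (a.curryLeft ∘L g)).curryLeft w =
      a.curryLeft (g w) + alternatizeUncurryFin ((a.curryLeft w).curryLeft ∘L g) := by
  rw [alternatize_cons, sub_eq_add_neg]
  congr 1
  rw [← alternatizeUncurryFinCLM_apply, ← alternatizeUncurryFinCLM_apply, ← map_neg]
  congr 1
  ext u : 1
  exact (curryLeft_curryLeft_swap a w (g u)).symm

lemma alternatize_zero_apply (f : E →L[ℝ] E [⋀^Fin 0]→L[ℝ] ℝ) (v : E) :
    (alternatizeUncurryFin f).curryLeft v = f v := by
  ext w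
  rw [curryLeft_apply_apply, alternatizeUncurryFin_apply]
  refine (Fin.sum_univ_one _).trans ?_
  simp only [Fin.coe_ofNat_eq_mod, Nat.zero_mod, pow_zero, one_smul]
  exact congrArg (f v) (Subsingleton.elim _ _)

variable [FiniteDimensional ℝ E]
  {M : Type*} [TopologicalSpace M] [ChartedSpace E M] [IsManifold 𝓘(ℝ, E) ∞ M]

lemma iota_iota {k : ℕ} (u v : VF E M) (α : Form E M (k + 2)) :
    iota u (iota v α) = -iota v (iota u α) :=
  Form.val_injective <| funext fun _ => curryLeft_curryLeft_swap _ _ _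

lemma lieDerivative_d (v : VF E M) : ∀ {k : ℕ} (α : Form E M k),
    lieDerivative v (k + 1) (Form.d α) = Form.d (lieDerivative v k α)
  | 0, α => by simp [lieDerivative, Form.d_d]
  | k + 1, α => by simp [lieDerivative, Form.d_d]

lemma VF.differentiableAt_inChart (v : VF E M) (x : M) :
    DifferentiableAt ℝ (vfInChart x v.val) (extChartAt 𝓘(ℝ, E) x x) :=
  (v.contDiffAt_inChart x).differentiableAt (by simp)

lemma inChart_iota_eventuallyEq {k : ℕ} (v : VF E M) (α : Form E M (k + 1)) (x : M) :
    inChart x (iota v α).val =ᶠ[𝓝 (extChartAt 𝓘(ℝ, E) x x)]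
      fun z => (inChart x α.val z).curryLeft (vfInChart x v.val z) := by
  filter_upwards [target_mem_nhds x] with y hy
  exact inChart_iota v α hy

/-- The coordinate formula for `L_v`, read in the chart at `x` itself, where the coordinate change
at the base point is the identity. The Cartan identities below come from comparing such expressions
pointwise. -/
lemma lieDerivative_val_succ {k : ℕ} (v : VF E M) (α : Form E M (k + 1)) (x : M) :
    (lieDerivative v (k + 1) α).val x =
      fderiv ℝ (inChart x α.val) (extChartAt 𝓘(ℝ, E) x x) (v.val x) +
        alternatizeUncurryFin ((α.val x).curryLeft ∘L
          fderiv ℝ (vfInChart x v.val) (extChartAt 𝓘(ℝ, E) x x)) := by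
  have h := extDeriv_curryLeft (α.differentiableAt_inChart x) (v.differentiableAt_inChart x)
  rw [vfInChart_self, inChart_self] at h
  rw [← h]
  change (Form.d (iota v α)).val x + (iota v (Form.d α)).val x = _
  rw [Form.d_val, (inChart_iota_eventuallyEq v α x).extDeriv_eq]
  rfl

lemma lieDerivative_val_zero (v : VF E M) (α : Form E M 0) (x : M) :
    (lieDerivative v 0 α).val x =
      fderiv ℝ (inChart x α.val) (extChartAt 𝓘(ℝ, E) x x) (v.val x) := by
  change (extDeriv _ _).curryLeft (v.val x) = _
  exact alternatize_zero_apply _ _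

lemma fderiv_inChart_iota {k : ℕ} (v : VF E M) (α : Form E M (k + 1)) (x : M) (u : E) :
    fderiv ℝ (inChart x (iota v α).val) (extChartAt 𝓘(ℝ, E) x x) u =
      (α.val x).curryLeft (fderiv ℝ (vfInChart x v.val) (extChartAt 𝓘(ℝ, E) x x) u) +
        (fderiv ℝ (inChart x α.val) (extChartAt 𝓘(ℝ, E) x x) u).curryLeft (v.val x) := by
  rw [(inChart_iota_eventuallyEq v α x).fderiv_eq, (hasFDerivAt_contract
    (α.differentiableAt_inChart x) (v.differentiableAt_inChart x)).fderiv, vfInChart_self,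
    inChart_self]
  rfl

/-- Cartan's formula for the commutator of a Lie derivative and an interior product. -/
theorem lieDerivative_iota (u w : VF E M) : ∀ {k : ℕ} (α : Form E M (k + 1)),
    lieDerivative u k (iota w α) = iota w (lieDerivative u (k + 1) α) + iota ⁅u, w⁆ α
  | 0, α => by
    refine Form.val_injective <| funext fun x => ?_
    rw [lieDerivative_val_zero, fderiv_inChart_iota, Form.val_add, Pi.add_apply, iota_val,
      iota_val, lieDerivative_val_succ, VF.bracket_val, lieBracket, vfInChart_self, vfInChart_self]
    have h := alternatize_zero_apply ((α.val x).curryLeft ∘L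
          fderiv ℝ (vfInChart x u.val) (extChartAt 𝓘(ℝ, E) x x)) (w.val x)
    rw [curryLeft_add, map_sub, _root_.add_apply, h]
    rw [ContinuousLinearMap.comp_apply]
    abel
  | k + 1, α => by
    refine Form.val_injective <| funext fun x => ?_
    -- The derivation of `ι_w α` by `Du` and the term `(Dα(u))(w, …)` occur on both sides. The
    -- difference is `α(Dw(u) - Du(w), …)`, and `Dw(u) - Du(w)` is the bracket in coordinates.
    rw [lieDerivative_val_succ, fderiv_inChart_iota, Form.val_add, Pi.add_apply, iota_val w α,
      iota_val w (lieDerivative u _ α), iota_val ⁅u, w⁆ α, lieDerivative_val_succ, VF.bracket_val,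
      lieBracket, vfInChart_self, vfInChart_self, curryLeft_add, map_sub, _root_.add_apply,
      curryLeft_alternatize_contract]
    abel

end Cartan

/-! ### Derivations of functions, and fields tangent to `N` or vanishing along it -/

section Functions

variable {E : Type*} [NormedAddCommGroup E] [NormedSpace ℝ E] [FiniteDimensional ℝ E]
  {M : Type*} [TopologicalSpace M] [ChartedSpace E M] [IsManifold 𝓘(ℝ, E) ∞ M]

/-- A smooth function, seen as a `0`-form. -/
def Form.ofFunction (f : C^∞⟮𝓘(ℝ, E), M; ℝ⟯) : Form E M 0 :=
  Form.ofChart (fun x => ContinuousAlternatingMap.constOfIsEmptyLIE ℝ E ℝ (Fin 0) (f x)) fun x =>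
    (ContinuousAlternatingMap.constOfIsEmptyLIE ℝ E ℝ (Fin 0)).contDiff.contDiffAt.comp _
      ((contMDiffAt_iff_inChart f x).1 (f.contMDiff x))

/-- A `0`-form, seen as a smooth function. -/
def Form.toFunction (α : Form E M 0) : C^∞⟮𝓘(ℝ, E), M; ℝ⟯ :=
  ⟨fun x => α.val x 0, fun x => (contMDiffAt_iff_inChart _ x).2 <|
    ((contDiff_eval (0 : Fin 0 → E)).contDiffAt.comp _
      (α.contDiffAt_inChart (mem_extChartAt_target x))).congr_of_eventuallyEq <|
        Filter.Eventually.of_forall fun _ => congrArg (α.val _) (Subsingleton.elim _ _)⟩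

lemma Form.val_zero_apply (α : Form E M 0) (x : M) (v : Fin 0 → E) :
    α.val x v = α.toFunction x := congrArg (α.val x) (Subsingleton.elim _ _)

/-- The derivative of a smooth function along a vector field is `ι_v d`. -/
lemma toFunction_iota_d (v : VF E M) (α : Form E M 0) (x : M) :
    (iota v (Form.d α)).toFunction x = mfderiv 𝓘(ℝ, E) 𝓘(ℝ, ℝ) α.toFunction x (v x) := by
  have h1 : (iota v (Form.d α)).toFunction x = (lieDerivative v 0 α).val x 0 := rfl
  have hd : MDifferentiableAt 𝓘(ℝ, E) 𝓘(ℝ, ℝ) α.toFunction x :=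
    (α.toFunction.contMDiff x).mdifferentiableAt (by simp)
  have h2 : writtenInExtChartAt 𝓘(ℝ, E) 𝓘(ℝ, ℝ) x α.toFunction =
      fun y => ContinuousAlternatingMap.apply ℝ E ℝ (0 : Fin 0 → E) (inChart x α.val y) := by
    funext y
    exact congrArg (α.val _) (Subsingleton.elim _ _)
  have h3 := ((ContinuousAlternatingMap.apply ℝ E ℝ (0 : Fin 0 → E)).hasFDerivAt.comp
    (extChartAt 𝓘(ℝ, E) x x) (α.differentiableAt_inChart x).hasFDerivAt).fderiv
  rw [h1, lieDerivative_val_zero, hd.mfderiv, h2]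
  simp only [modelWithCornersSelf_coe, range_id]
  rw [fderivWithin_univ]
  exact (DFunLike.congr_fun h3 (v.val x)).symm

/-- The derivative of a smooth function along a vector field. -/
def VF.deriv (v : VF E M) (f : C^∞⟮𝓘(ℝ, E), M; ℝ⟯) : C^∞⟮𝓘(ℝ, E), M; ℝ⟯ :=
  (iota v (Form.d (Form.ofFunction f))).toFunction

lemma VF.deriv_apply (v : VF E M) (f : C^∞⟮𝓘(ℝ, E), M; ℝ⟯) (x : M) :
    v.deriv f x = mfderiv 𝓘(ℝ, E) 𝓘(ℝ, ℝ) f x (v x) := toFunction_iota_d v _ x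

lemma Form.ofFunction_toFunction (α : Form E M 0) : Form.ofFunction α.toFunction = α :=
  Form.val_injective <| funext fun x => by
    ext v
    exact (α.val_zero_apply x v).symm

/-- This is `lieDerivative_iota` applied to `df`, since `L_u` commutes with `d`. It lets the closure
properties of tangent and vanishing fields be proved on functions alone. -/
lemma VF.deriv_lie (u v : VF E M) (f : C^∞⟮𝓘(ℝ, E), M; ℝ⟯) :
    u.deriv (v.deriv f) = v.deriv (u.deriv f) + VF.deriv ⁅u, v⁆ f := by
  have h := lieDerivative_iota u v (Form.d (Form.ofFunction f))
  rw [lieDerivative_d] at h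
  unfold VF.deriv
  rw [Form.ofFunction_toFunction, Form.ofFunction_toFunction]
  exact congrArg Form.toFunction h

lemma mem_tangentFields {N : Set M} {u : VF E M} : u ∈ tangentFields N ↔
    ∀ f : C^∞⟮𝓘(ℝ, E), M; ℝ⟯, (∀ x ∈ N, f x = 0) → ∀ x ∈ N, u.deriv f x = 0 := by
  simp only [VF.deriv_apply]; rfl

lemma mem_vanishingFields {N : Set M} {u : VF E M} : u ∈ vanishingFields N ↔
    ∀ f : C^∞⟮𝓘(ℝ, E), M; ℝ⟯, ∀ x ∈ N, u.deriv f x = 0 := by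
  simp only [VF.deriv_apply]; rfl

lemma lie_mem_tangentFields {N : Set M} {u v : VF E M} (hu : u ∈ tangentFields N)
    (hv : v ∈ tangentFields N) : ⁅u, v⁆ ∈ tangentFields N := by
  rw [mem_tangentFields] at *
  intro f hf x hx
  have h := DFunLike.congr_fun (VF.deriv_lie u v f) x
  rw [ContMDiffMap.coe_add, Pi.add_apply, hu _ (hv f hf) x hx, hv _ (hu f hf) x hx, zero_add] at h
  exact h.symm

/-- In `[u,v]f = u(vf) - v(uf)` the second term vanishes on `N` because `v` does, and the first
because `vf` lies in `I_N` and `u` is tangent. -/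
lemma lie_mem_vanishingFields {N : Set M} {u v : VF E M} (hu : u ∈ tangentFields N)
    (hv : v ∈ vanishingFields N) : ⁅u, v⁆ ∈ vanishingFields N := by
  rw [mem_tangentFields] at hu
  rw [mem_vanishingFields] at *
  intro f x hx
  have h := DFunLike.congr_fun (VF.deriv_lie u v f) x
  rw [ContMDiffMap.coe_add, Pi.add_apply, hu _ (hv f) x hx, hv _ x hx, zero_add] at h
  exact h.symm

/-- Smooth functions detect tangent vectors: a linear functional in the chart at `x`, cut off by a
bump function, has that functional as its differential at `x`. Hausdorffness makes the extension by
zero smooth. -/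
lemma eq_zero_of_mem_vanishingFields [T2Space M] {N : Set M} {u : VF E M}
    (hu : u ∈ vanishingFields N) {x : M} (hx : x ∈ N) : u.val x = 0 := by
  by_contra h0
  obtain ⟨l, hl⟩ := SeparatingDual.exists_ne_zero (R := ℝ) h0
  obtain ⟨b⟩ : Nonempty (SmoothBumpFunction 𝓘(ℝ, E) x) := inferInstance
  have hs : ContMDiff 𝓘(ℝ, E) 𝓘(ℝ, ℝ) ∞ fun y => b y • l (extChartAt 𝓘(ℝ, E) x y) :=
    b.contMDiff_smul (l.contMDiff.comp_contMDiffOn contMDiffOn_extChartAt)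
  have h1 := hu ⟨_, hs⟩ x hx
  have h2 : (fun y => b y • l (extChartAt 𝓘(ℝ, E) x y)) =ᶠ[𝓝 x] l ∘ extChartAt 𝓘(ℝ, E) x := by
    filter_upwards [b.eventuallyEq_one] with y hy
    simp [hy]
  have h3 : mfderiv 𝓘(ℝ, E) 𝓘(ℝ, E) (extChartAt 𝓘(ℝ, E) x) x = ContinuousLinearMap.id ℝ E := by
    have hx := mem_chart_source E x
    have h1 := TangentBundle.continuousLinearMapAt_trivializationAt (I := 𝓘(ℝ, E)) hx
    have h2 := TangentBundle.continuousLinearMapAt_trivializationAt_eq_core (I := 𝓘(ℝ, E)) hx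
    rw [← h1, h2]
    ext u
    exact tangentCoordChange_self (mem_extChartAt_source _)
  have h4 : mfderiv 𝓘(ℝ, E) 𝓘(ℝ, ℝ) (l ∘ extChartAt 𝓘(ℝ, E) x) x =
      l ∘L mfderiv 𝓘(ℝ, E) 𝓘(ℝ, E) (extChartAt 𝓘(ℝ, E) x) x := by
    rw [mfderiv_comp x l.mdifferentiableAt (contMDiffAt_extChartAt.mdifferentiableAt (n := ∞)
      (by simp)), ContinuousLinearMap.mfderiv_eq]
    rfl
  refine hl ?_
  change mfderiv 𝓘(ℝ, E) 𝓘(ℝ, ℝ) (fun y => b y • l (extChartAt 𝓘(ℝ, E) x y)) x (u x) = 0 at h1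
  rw [h2.mfderiv_eq, h4, h3] at h1
  exact h1

lemma VF.val_smul (f : C^∞⟮𝓘(ℝ, E), M; ℝ⟯) (v : VF E M) (x : M) :
    (f • v).val x = f x • v.val x := rfl

lemma VF.lie_smul_function (u v : VF E M) (f : C^∞⟮𝓘(ℝ, E), M; ℝ⟯) :
    ⁅u, f • v⁆ = u.deriv f • v + f • ⁅u, v⁆ := by
  have := FiniteDimensional.complete ℝ E
  have : IsManifold 𝓘(ℝ, E) (minSmoothness ℝ 2) M := IsManifold.of_le minSmoothness_two_le
  ext x : 1
  have h := mlieBracket_smul_right (I := 𝓘(ℝ, E)) (V := fun y => u y) (W := fun y => v y) (f := f)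
    ((f.contMDiff x).mdifferentiableAt (by simp)) (v.mdiff x)
  exact h.trans (congrArg₂ (· + ·) (congrArg (· • v.val x) (u.deriv_apply f x).symm) rfl)

end Functions

/-! ### The differential ideal of forms vanishing along `N` -/

section VanishingIdeal

variable {E : Type*} [NormedAddCommGroup E] [NormedSpace ℝ E] [FiniteDimensional ℝ E]
  {M : Type*} [TopologicalSpace M] [ChartedSpace E M] [IsManifold 𝓘(ℝ, E) ∞ M]
  {N : Set M} {j k : ℕ}

/-- The set `vanishingGenerators N k`, as a subspace. -/
def vanishingSubmodule (E : Type*) [NormedAddCommGroup E] [NormedSpace ℝ E] [FiniteDimensional ℝ E]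
    {M : Type*} [TopologicalSpace M] [ChartedSpace E M] [IsManifold 𝓘(ℝ, E) ∞ M]
    (N : Set M) (k : ℕ) : Submodule ℝ (Form E M k) where
  carrier := vanishingGenerators N k
  add_mem' hα hβ u hu x hx := by
    rw [Form.val_add, Pi.add_apply, ContinuousAlternatingMap.add_apply, hα u hu x hx, hβ u hu x hx,
      add_zero]
  zero_mem' _ _ _ _ := rfl
  smul_mem' c α hα u hu x hx := by
    rw [Form.val_smul, Pi.smul_apply, ContinuousAlternatingMap.smul_apply, hα u hu x hx, smul_zero]

lemma mem_vanishingSubmodule_zero {α : Form E M 0} :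
    α ∈ vanishingSubmodule E N 0 ↔ ∀ x ∈ N, α.toFunction x = 0 :=
  ⟨fun h x hx => (α.val_zero_apply x _).symm.trans (h Fin.elim0 (fun i => i.elim0) x hx),
    fun h _ _ x hx => (α.val_zero_apply x _).trans (h x hx)⟩

/-- Contraction with tangent fields lowers the degree, so membership can be proved by induction,
starting from functions. -/
lemma mem_vanishingSubmodule_succ {α : Form E M (k + 1)} :
    α ∈ vanishingSubmodule E N (k + 1) ↔
      ∀ u ∈ tangentFields N, iota u α ∈ vanishingSubmodule E N k := by
  constructor
  · intro h u hu w hw x hx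
    refine Eq.trans ?_ (h (Fin.cons u w) (Fin.cases hu hw) x hx)
    refine congrArg (α.val x) (funext fun i => ?_)
    refine Fin.cases rfl (fun i => rfl) i
  · intro h u hu x hx
    refine Eq.trans ?_ (h (u 0) (hu 0) (Fin.tail u) (fun i => hu i.succ) x hx)
    refine congrArg (α.val x) (funext fun i => ?_)
    refine Fin.cases rfl (fun i => rfl) i

/-- Every shuffle summand contains `α` evaluated on some of the given tangent fields, hence a zero
factor. -/
lemma wedge_mem_left {α : Form E M j} (hα : α ∈ vanishingSubmodule E N j) (β : Form E M k) :
    α.wedge β ∈ vanishingSubmodule E N (j + k) := by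
  intro u hu x hx
  refine (wedgeAt_apply _ _ _).trans (Finset.sum_eq_zero fun σ _ => ?_)
  induction σ using Quotient.inductionOn' with | _ σ
  rw [wedgeSummand_mk]
  have h := hα (fun i => u (finSumFinEquiv (σ (Sum.inl i)))) (fun _ => hu _) x hx
  simp only [Function.comp]
  rw [h, zero_mul, smul_zero]

lemma wedge_mem_right (α : Form E M j) {β : Form E M k} (hβ : β ∈ vanishingSubmodule E N k) :
    α.wedge β ∈ vanishingSubmodule E N (j + k) := by
  intro u hu x hx
  refine (wedgeAt_apply _ _ _).trans (Finset.sum_eq_zero fun σ _ => ?_)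
  induction σ using Quotient.inductionOn' with | _ σ
  rw [wedgeSummand_mk]
  have h := hβ (fun i => u (finSumFinEquiv (σ (Sum.inr i)))) (fun _ => hu _) x hx
  simp only [Function.comp]
  rw [h, mul_zero, smul_zero]

/-- Both claims go through one induction on the degree. Contracting `L_u α` with a tangent `w` gives
`L_u ι_w α - ι_[u,w] α`, which has lower degree and involves only tangent fields; then `ι_u dα = L_u
α - d ι_u α` settles `dα`. On functions `ι_u df = uf`, and tangency of `u` is exactly what is
needed. -/
lemma d_and_lieDerivative_mem : ∀ {k : ℕ} {α : Form E M k}, α ∈ vanishingSubmodule E N k →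
    Form.d α ∈ vanishingSubmodule E N (k + 1) ∧
      ∀ u ∈ tangentFields N, lieDerivative u k α ∈ vanishingSubmodule E N k
  | 0, α, hα => by
    have h : ∀ u ∈ tangentFields N, iota u (Form.d α) ∈ vanishingSubmodule E N 0 := by
      intro u hu
      rw [mem_vanishingSubmodule_zero] at *
      intro x hx
      rw [toFunction_iota_d]
      exact hu _ hα x hx
    exact ⟨mem_vanishingSubmodule_succ.2 h, h⟩
  | k + 1, α, hα => by
    have hi := mem_vanishingSubmodule_succ.1 hα
    have hL : ∀ u ∈ tangentFields N, lieDerivative u (k + 1) α ∈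
        vanishingSubmodule E N (k + 1) := by
      intro u hu
      rw [mem_vanishingSubmodule_succ]
      intro w hw
      rw [← add_sub_cancel_right (iota w (lieDerivative u (k + 1) α)) (iota ⁅u, w⁆ α),
        ← lieDerivative_iota]
      exact sub_mem ((d_and_lieDerivative_mem (hi w hw)).2 u hu) (hi _ (lie_mem_tangentFields hu hw))
    refine ⟨mem_vanishingSubmodule_succ.2 fun u hu => ?_, hL⟩
    have h : lieDerivative u (k + 1) α = Form.d (iota u α) + iota u (Form.d α) := rfl
    rw [← add_sub_cancel_left (Form.d (iota u α)) (iota u (Form.d α)), ← h]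
    exact sub_mem (hL u hu) (d_and_lieDerivative_mem (hi u hu)).1

lemma isDifferentialIdeal_vanishingSubmodule :
    IsDifferentialIdeal (vanishingSubmodule E (M := M) N) where
  d_mem h := (d_and_lieDerivative_mem h).1
  wedge_mem_left β h := wedge_mem_left h β
  wedge_mem_right α _ h := wedge_mem_right α h

/-- The forms that vanish on the tangent vector fields already form a differential ideal. -/
theorem vanishingForms_eq : vanishingForms N k = vanishingSubmodule E (M := M) N k :=
  le_antisymm (fun _ h => h _ isDifferentialIdeal_vanishingSubmodule fun _ _ h => h)
    fun _ h _ _ hN => hN _ h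

lemma d_mem_vanishingForms {α : Form E M k} (h : α ∈ vanishingForms N k) :
    Form.d α ∈ vanishingForms N (k + 1) := by
  rw [vanishingForms_eq] at *
  exact (d_and_lieDerivative_mem h).1

lemma iota_mem_vanishingForms {u : VF E M} (hu : u ∈ tangentFields N) {α : Form E M (k + 1)}
    (h : α ∈ vanishingForms N (k + 1)) : iota u α ∈ vanishingForms N k := by
  rw [vanishingForms_eq] at *
  exact mem_vanishingSubmodule_succ.1 h u hu

/-- The field `w` is zero at each point of `N`, so the contraction vanishes there whatever `α` is.
-/
lemma iota_mem_vanishingForms_of_mem_vanishingFields [T2Space M] {w : VF E M}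
    (hw : w ∈ vanishingFields N) (α : Form E M (k + 1)) : iota w α ∈ vanishingForms N k := by
  rw [vanishingForms_eq]
  intro u _ x hx
  rw [iota_val, eq_zero_of_mem_vanishingFields hw hx, _root_.map_zero]
  rfl

lemma iota_smul_mem_vanishingForms (f : C^∞⟮𝓘(ℝ, E), M; ℝ⟯) {v : VF E M} {α : Form E M (k + 1)}
    (h : iota v α ∈ vanishingForms N k) : iota (f • v) α ∈ vanishingForms N k := by
  rw [vanishingForms_eq] at *
  intro u hu x hx
  have h1 := h u hu x hx
  rw [iota_val] at *
  rw [VF.val_smul, map_smul, ContinuousAlternatingMap.smul_apply, h1, smul_zero]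

lemma smul_mem_vanishingFields (f : C^∞⟮𝓘(ℝ, E), M; ℝ⟯) {w : VF E M}
    (hw : w ∈ vanishingFields N) : f • w ∈ vanishingFields N := by
  intro g x hx
  refine ((mfderiv 𝓘(ℝ, E) 𝓘(ℝ, ℝ) g x).map_smul (f x) (w x)).trans ?_
  rw [hw g x hx, smul_zero]

end VanishingIdeal

/-! ### Reducible fields and forms are stable under the operations -/

section ReducibleClosure

variable {E : Type*} [NormedAddCommGroup E] [NormedSpace ℝ E] [FiniteDimensional ℝ E]
  {M : Type*} [TopologicalSpace M] [ChartedSpace E M] [IsManifold 𝓘(ℝ, E) ∞ M]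
  {𝔤 : Type*} [LieRing 𝔤] [LieAlgebra ℝ 𝔤] {ρ : 𝔤 →ₗ⁅ℝ⁆ VF E M} {N : Set M} {k : ℕ}

/-- From `L_ξ dα = d L_ξ α` and `ι_ξ dα = L_ξ α - d ι_ξ α`, where the last term is absent for
functions. -/
lemma d_mem_reducibleForms : ∀ {k : ℕ} {α : Form E M k}, α ∈ reducibleForms ρ N k →
    Form.d α ∈ reducibleForms ρ N (k + 1)
  | 0, α, hα => fun ξ => ⟨by
      rw [lieDerivative_d]
      exact d_mem_vanishingForms (hα ξ).1, (hα ξ).1⟩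
  | k + 1, α, hα => fun ξ => ⟨by
      rw [lieDerivative_d]
      exact d_mem_vanishingForms (hα ξ).1, by
      have h : lieDerivative (ρ ξ) (k + 1) α =
        Form.d (iota (ρ ξ) α) + iota (ρ ξ) (Form.d α) := rfl
      change iota (ρ ξ) (Form.d α) ∈ vanishingForms N (k + 1)
      rw [← add_sub_cancel_left (Form.d (iota (ρ ξ) α)) (iota (ρ ξ) (Form.d α)), ← h]
      exact sub_mem (hα ξ).1 (d_mem_vanishingForms (hα ξ).2)⟩

/-- Contraction is linear over smooth functions, so on the span of the fundamental fields the
condition `ι_ξ α ∈ I_Ω(N)` suffices; on the vanishing part nothing about `α` is needed. -/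
lemma iota_mem_vanishingForms_of_mem_sup [T2Space M] {y : VF E M} {α : Form E M (k + 1)}
    (hα : α ∈ reducibleForms ρ N (k + 1))
    (hy : y ∈ (fundamentalFields ρ).restrictScalars ℝ ⊔ vanishingFields N) :
    iota y α ∈ vanishingForms N k := by
  obtain ⟨a, ha, b, hb, rfl⟩ := Submodule.mem_sup.1 hy
  rw [_root_.map_add, LinearMap.add_apply]
  refine add_mem ?_ (iota_mem_vanishingForms_of_mem_vanishingFields hb α)
  have ha' : a ∈ Submodule.span C^∞⟮𝓘(ℝ, E), M; ℝ⟯ (range ρ) := ha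
  clear hy ha
  induction ha' using Submodule.span_induction with
  | mem z hz =>
    obtain ⟨ξ, rfl⟩ := hz
    exact (hα ξ).2
  | zero =>
    rw [_root_.map_zero, LinearMap.zero_apply]
    exact zero_mem _
  | add a b _ _ iha ihb =>
    rw [_root_.map_add, LinearMap.add_apply]
    exact add_mem iha ihb
  | smul f a _ iha =>
    exact iota_smul_mem_vanishingForms f iha

lemma iota_mem_reducibleForms [T2Space M] {v : VF E M} (hv : v ∈ reducibleFields ρ N)
    {α : Form E M (k + 1)} (hα : α ∈ reducibleForms ρ N (k + 1)) :
    iota v α ∈ reducibleForms ρ N k := by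
  intro ξ
  constructor
  -- Cartan's commutator yields `[ξ, v]`, while the definition of a reducible field speaks of `[v,
  -- ξ]`; hence the sign.
  · rw [lieDerivative_iota, ← lie_skew, _root_.map_neg, LinearMap.neg_apply]
    exact add_mem (iota_mem_vanishingForms hv.1 (hα ξ).1)
      (neg_mem (iota_mem_vanishingForms_of_mem_sup hα (hv.2 ξ)))
  -- If `ι_v α` is a function, its contraction is zero by convention.
  · cases k with
    | zero => exact zero_mem _
    | succ k =>
      change iota (ρ ξ) (iota v α) ∈ vanishingForms N k
      rw [iota_iota]
      exact neg_mem (iota_mem_vanishingForms hv.1 (hα ξ).2)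

/-- The sum is formed as a real subspace, but it is a module over the smooth functions, which the
Leibniz rule in `lie_mem_sup` needs. -/
lemma smul_mem_sup (f : C^∞⟮𝓘(ℝ, E), M; ℝ⟯) {y : VF E M}
    (hy : y ∈ (fundamentalFields ρ).restrictScalars ℝ ⊔ vanishingFields N) :
    f • y ∈ (fundamentalFields ρ).restrictScalars ℝ ⊔ vanishingFields N := by
  obtain ⟨a, ha, b, hb, rfl⟩ := Submodule.mem_sup.1 hy
  rw [smul_add]
  exact Submodule.add_mem_sup (Submodule.smul_mem (fundamentalFields ρ) f ha)
    (smul_mem_vanishingFields f hb)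

/-- On generators this is reducibility of `v`; it extends to their span by `[v, f a] = (vf) a + f
[v, a]`. On vanishing fields it follows from tangency of `v`. -/
lemma lie_mem_sup {v : VF E M} (hv : v ∈ reducibleFields ρ N) {y : VF E M}
    (hy : y ∈ (fundamentalFields ρ).restrictScalars ℝ ⊔ vanishingFields N) :
    ⁅v, y⁆ ∈ (fundamentalFields ρ).restrictScalars ℝ ⊔ vanishingFields N := by
  obtain ⟨a, ha, b, hb, rfl⟩ := Submodule.mem_sup.1 hy
  rw [lie_add]
  refine add_mem ?_ (Submodule.mem_sup_right (lie_mem_vanishingFields hv.1 hb))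
  have ha' : a ∈ Submodule.span C^∞⟮𝓘(ℝ, E), M; ℝ⟯ (range ρ) := ha
  clear hy ha
  induction ha' using Submodule.span_induction with
  | mem z hz =>
    obtain ⟨ξ, rfl⟩ := hz
    exact hv.2 ξ
  | zero =>
    rw [lie_zero]
    exact zero_mem _
  | add a b _ _ iha ihb =>
    rw [lie_add]
    exact add_mem iha ihb
  | smul f a hha iha =>
    rw [VF.lie_smul_function]
    exact add_mem (smul_mem_sup _ (Submodule.mem_sup_left hha))
      (smul_mem_sup f iha)

lemma lie_mem_reducibleFields {v w : VF E M} (hv : v ∈ reducibleFields ρ N)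
    (hw : w ∈ reducibleFields ρ N) : ⁅v, w⁆ ∈ reducibleFields ρ N := by
  refine ⟨lie_mem_tangentFields hv.1 hw.1, fun ξ => ?_⟩
  rw [lie_lie]
  exact sub_mem (lie_mem_sup hv (hw.2 ξ)) (lie_mem_sup hw (hv.2 ξ))

lemma iotas_mem_reducibleForms [T2Space M] : ∀ {k p : ℕ} {v : Fin k → VF E M}
    {α : Form E M (p + k)}, (∀ i, v i ∈ reducibleFields ρ N) → α ∈ reducibleForms ρ N (p + k) →
      iotas k v α ∈ reducibleForms ρ N p
  | 0, _, _, _, _, hα => hα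
  | _ + 1, _, v, α, hv, hα => iotas_mem_reducibleForms (v := Fin.tail v) (α := iota (v 0) α)
      (fun i => hv i.succ) (iota_mem_reducibleForms (hv 0) hα)

lemma cast_mem_reducibleForms {p q : ℕ} (h : p = q) {α : Form E M p}
    (hα : α ∈ reducibleForms ρ N p) : h ▸ α ∈ reducibleForms ρ N q := by
  subst h
  exact hα

variable {m : ℕ} {Ω : PrePlectic E M m}

lemma Ham.dForm_mem_reducibleForms {x : Ham Ω} (hx : x ∈ reducibleObservables Ω ρ N) :
    ∀ k, x.dForm k ∈ reducibleForms ρ N k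
  | 0 => zero_mem _
  | k + 1 => by
    by_cases h : k < m
    · rw [Ham.dForm, dif_pos h]
      exact d_mem_reducibleForms (hx.2.2 ⟨k, h⟩)
    · rw [Ham.dForm, dif_neg h]
      exact zero_mem _

/-- The reducible observables are closed under the multibrackets. -/
theorem bracket_mem_reducibleObservables [T2Space M]
    (hΩ : Ω.form ∈ reducibleForms ρ N (m + 2)) : ∀ (k : ℕ) {x : Fin k → Ham Ω},
    (∀ i, x i ∈ reducibleObservables Ω ρ N) → Ham.bracket Ω k x ∈ reducibleObservables Ω ρ N
  | 0, _, _ => zero_mem _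
  | 1, _, hx => ⟨zero_mem _, Ham.dForm_mem_reducibleForms (hx 0) m,
      fun k => Ham.dForm_mem_reducibleForms (hx 0) k⟩
  | 2, _, hx => ⟨lie_mem_reducibleFields (hx 0).1 (hx 1).1, Submodule.smul_mem _ _
      (iotas_mem_reducibleForms (Fin.cases (hx 0).1 (Fin.cases (hx 1).1 fun i => i.elim0)) hΩ),
      fun _ => zero_mem _⟩
  | k + 3, x, hx => ⟨zero_mem _, zero_mem _, fun p => by
      change (if h : m + 2 = p + (k + 3) then _ else _ : Form E M p) ∈ _
      split_ifs with h
      · exact Submodule.smul_mem _ _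
          (iotas_mem_reducibleForms (fun i => (hx i).1) (cast_mem_reducibleForms h hΩ))
      · exact zero_mem _⟩

end ReducibleClosure

/-! ### Iterated contractions and the iterated Cartan formula -/

section Contractions

variable {E : Type*} [NormedAddCommGroup E] [NormedSpace ℝ E] [FiniteDimensional ℝ E]
  {M : Type*} [TopologicalSpace M] [ChartedSpace E M] [IsManifold 𝓘(ℝ, E) ∞ M]

/-- The tuple `(v₁, …, v_k, w₁, …, w_p)`. -/
def joinTuple {E : Type*} {k p : ℕ} (v : Fin k → E) (w : Fin p → E) (i : Fin (p + k)) : E :=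
  if h : (i : ℕ) < k then v ⟨i, h⟩ else w ⟨i - k, by omega⟩

lemma joinTuple_castLE {E : Type*} {k p : ℕ} (v : Fin k → E) (w : Fin p → E) (i : Fin k) :
    joinTuple v w (Fin.castLE (Nat.le_add_left k p) i) = v i := dif_pos i.2

lemma joinTuple_update {E : Type*} {k p : ℕ} (v : Fin k → E) (w : Fin p → E) (i : Fin k) (a : E) :
    joinTuple (Function.update v i a) w =
      Function.update (joinTuple v w) (Fin.castLE (Nat.le_add_left k p) i) a := by
  funext j
  simp only [joinTuple, Function.update_apply, Fin.ext_iff, Fin.val_castLE]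
  split_ifs <;> first | rfl | omega

/-- Identifies the iterated contraction with evaluation on a longer tuple, so that multilinearity
and alternation in the fields are inherited from `α` pointwise. -/
lemma iotas_val : ∀ {k p : ℕ} (v : Fin k → VF E M) (α : Form E M (p + k)) (x : M) (w : Fin p → E),
    (iotas k v α).val x w = α.val x (joinTuple (fun i => (v i).val x) w)
  | 0, _, _, _, _, _ => rfl
  | k + 1, p, v, α, x, w => by
    change (iotas k (Fin.tail v) (iota (v 0) α)).val x w = _
    rw [iotas_val, iota_val, curryLeft_apply_apply]
    refine congrArg (α.val x) (funext fun i => ?_)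
    refine Fin.cases rfl (fun i => ?_) i
    simp only [Matrix.cons_val_succ, joinTuple, Fin.val_succ, Nat.add_lt_add_iff_right,
      Nat.add_sub_add_right]
    rfl

lemma VF.val_update {k : ℕ} (v : Fin k → VF E M) (i : Fin k) (a : VF E M) (x : M) :
    (fun j => (Function.update v i a j).val x) =
      Function.update (fun j => (v j).val x) i (a.val x) := by
  funext j
  by_cases h : j = i
  · subst h
    rw [Function.update_self, Function.update_self]
  · rw [Function.update_of_ne h, Function.update_of_ne h]

lemma Form.neg_smul {k : ℕ} (c : ℝ) (α : Form E M k) : -c • α = -(c • α) := _root_.neg_smul c α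

lemma Form.smul_neg {k : ℕ} (c : ℝ) (α : Form E M k) : c • -α = -(c • α) := _root_.smul_neg c α

lemma Form.smul_add {k : ℕ} (c : ℝ) (α β : Form E M k) : c • (α + β) = c • α + c • β :=
  _root_.smul_add c α β

lemma Form.smul_zero {k : ℕ} (c : ℝ) : c • (0 : Form E M k) = 0 := _root_.smul_zero (A := Form E M k) c

/-- The iterated contraction, as an alternating map of the vector fields. -/
def iotasAlternating (k : ℕ) {p : ℕ} (α : Form E M (p + k)) :
    VF E M [⋀^Fin k]→ₗ[ℝ] Form E M p where
  toFun v := iotas k v α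
  map_update_add' {inst} v i a b := by
    rw [Subsingleton.elim inst (instDecidableEqFin k)]
    refine Form.val_injective <| funext fun x => ContinuousAlternatingMap.ext fun w => ?_
    rw [Form.val_add, Pi.add_apply, ContinuousAlternatingMap.add_apply]
    simp only [iotas_val, VF.val_update, joinTuple_update]
    exact (α.val x).map_update_add _ _ _ _
  map_update_smul' {inst} v i c a := by
    rw [Subsingleton.elim inst (instDecidableEqFin k)]
    refine Form.val_injective <| funext fun x => ContinuousAlternatingMap.ext fun w => ?_
    rw [Form.val_smul, Pi.smul_apply, ContinuousAlternatingMap.smul_apply]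
    simp only [iotas_val, VF.val_update, joinTuple_update]
    exact (α.val x).map_update_smul _ _ _ _
  map_eq_zero_of_eq' v i j h hij := by
    refine Form.val_injective <| funext fun x => ContinuousAlternatingMap.ext fun w => ?_
    simp only [iotas_val]
    refine (α.val x).map_eq_zero_of_eq _ (i := Fin.castLE (Nat.le_add_left k p) i)
      (j := Fin.castLE (Nat.le_add_left k p) j) ?_ (fun h => hij (Fin.castLE_injective _ h))
    rw [joinTuple_castLE, joinTuple_castLE, h]

lemma iotas_add {k p : ℕ} (v : Fin k → VF E M) (α β : Form E M (p + k)) :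
    iotas k v (α + β) = iotas k v α + iotas k v β := by
  refine Form.val_injective <| funext fun x => ContinuousAlternatingMap.ext fun w => ?_
  rw [Form.val_add, Pi.add_apply, ContinuousAlternatingMap.add_apply]
  simp only [iotas_val]
  rfl

lemma iotas_neg {k p : ℕ} (v : Fin k → VF E M) (α : Form E M (p + k)) :
    iotas k v (-α) = -iotas k v α := by
  refine Form.val_injective <| funext fun x => ContinuousAlternatingMap.ext fun w => ?_
  rw [Form.val_neg, Pi.neg_apply, ContinuousAlternatingMap.neg_apply]
  simp only [iotas_val]
  rfl

lemma iotas_sub {k p : ℕ} (v : Fin k → VF E M) (α β : Form E M (p + k)) :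
    iotas k v (α - β) = iotas k v α - iotas k v β := by
  rw [sub_eq_add_neg, iotas_add, iotas_neg, ← sub_eq_add_neg]

lemma iotas_zero {k p : ℕ} (v : Fin k → VF E M) : iotas k v (0 : Form E M (p + k)) = 0 := by
  rw [← sub_self (0 : Form E M (p + k)), iotas_sub, sub_self]

lemma iotas_cons {k p : ℕ} (u : VF E M) (v : Fin k → VF E M) (α : Form E M (p + (k + 1))) :
    iotas (k + 1) (Fin.cons u v : Fin (k + 1) → VF E M) α = iotas k v (iota u α) := rfl

lemma iotas_succ {k p : ℕ} (v : Fin (k + 1) → VF E M) (α : Form E M (p + (k + 1))) :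
    iotas (k + 1) v α = iotas k (Fin.tail v) (iota (v 0) α) := rfl

lemma removeNth_succ {A : Type*} {n : ℕ} (v : Fin (n + 2) → A) (i : Fin (n + 1)) :
    i.succ.removeNth v = (Fin.cons (v 0) (i.removeNth (Fin.tail v)) : Fin (n + 1) → A) := by
  funext j
  refine Fin.cases ?_ (fun j => ?_) j
  · simp [Fin.removeNth]
  · simp [Fin.removeNth, Fin.tail]

/-- The sum over the pairs `a < b` of `(-1)^{a + b - 1} ι([v_a, v_b] ∧ v₀ ∧ ⋯ ∧ v_n) α`, where `v_a`
and `v_b` are left out. -/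
def bracketSum : ∀ (n : ℕ) {r : ℕ}, (Fin (n + 1) → VF E M) → Form E M (r + n) → Form E M r
  | 0, _, _, _ => 0
  | n + 1, _, v, α => ∑ i : Fin (n + 2), ∑ j : Fin (n + 1), if i ≤ j.castSucc then
      (-1 : ℝ) ^ (i + j : ℕ) • iotas (n + 1)
        (Fin.cons ⁅v i, v (i.succAbove j)⁆ (j.removeNth (i.removeNth v)) : Fin (n + 1) → VF E M) α
      else 0

lemma neg_one_pow_succ_add_succ (a b : ℕ) : (-1 : ℝ) ^ (a + 1 + (b + 1)) = (-1) ^ (a + b) := by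
  ring

/-- The bracket is contracted first and `v 0` second; exchanging these two contractions costs the
sign. -/
lemma iotas_bracket_succ {n r : ℕ} (v : Fin (n + 3) → VF E M) (α : Form E M (r + (n + 2)))
    (i : Fin (n + 2)) (j : Fin (n + 1)) :
    iotas (n + 2) (Fin.cons ⁅v i.succ, v (i.succ.succAbove j.succ)⁆
        (j.succ.removeNth (i.succ.removeNth v)) : Fin (n + 2) → VF E M) α =
      -iotas (n + 1) (Fin.cons ⁅Fin.tail v i, Fin.tail v (i.succAbove j)⁆
        (j.removeNth (i.removeNth (Fin.tail v))) : Fin (n + 1) → VF E M) (iota (v 0) α) := by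
  have e : (Fin.cons (v 0) (i.removeNth (Fin.tail v)) : Fin (n + 2) → VF E M) 0 = v 0 := rfl
  rw [removeNth_succ v, removeNth_succ, iotas_cons, iotas_cons, Fin.tail_cons, iotas_cons, e,
    iota_iota, iotas_neg, Fin.succ_succAbove_succ]
  rfl

/-- The pairs containing index `0` give the first sum. In all others `v 0` is a spectator, and
contracting it first costs a sign. -/
lemma bracketSum_succ : ∀ (n : ℕ) {r : ℕ} (v : Fin (n + 2) → VF E M) (α : Form E M (r + (n + 1))),
    bracketSum (n + 1) v α = ∑ j : Fin (n + 1), (-1 : ℝ) ^ (j : ℕ) •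
      iotas n (j.removeNth (Fin.tail v)) (iota ⁅v 0, v j.succ⁆ α) -
        bracketSum n (Fin.tail v) (iota (v 0) α)
  | 0, r, v, α => by
    rw [bracketSum, bracketSum, Fin.sum_univ_succ, sub_zero]
    simp [iotas_cons, Fin.removeNth_zero]
  | n + 1, r, v, α => by
    rw [bracketSum, bracketSum, Fin.sum_univ_succ, sub_eq_add_neg, ← Finset.sum_neg_distrib]
    congr 1
    · refine Finset.sum_congr rfl fun j _ => ?_
      rw [if_pos (Fin.zero_le _), iotas_cons, Fin.removeNth_zero, Fin.val_zero, zero_add,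
        Fin.succAbove_zero]
    · refine Finset.sum_congr rfl fun i _ => ?_
      -- Both indices are shifted by one. For a first index `i.succ`, the second index `0` would
      -- denote a pair in the wrong order and contributes nothing.
      rw [Fin.sum_univ_succ, if_neg (by simp), zero_add, ← Finset.sum_neg_distrib]
      refine Finset.sum_congr rfl fun j _ => ?_
      by_cases h : i ≤ j.castSucc
      · rw [if_pos h, if_pos (by simpa using h), Fin.val_succ, Fin.val_succ,
          neg_one_pow_succ_add_succ, iotas_bracket_succ, Form.smul_neg]
      · rw [if_neg h, if_neg (by simpa using h), neg_zero]

/-- The difference between `ι(v₀ ∧ ⋯ ∧ v_n) dα` and the part of Cartan's formula for it that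
involves Lie derivatives and brackets. -/
def cartanDefect (n : ℕ) {r : ℕ} (v : Fin (n + 1) → VF E M) (α : Form E M (r + n)) : Form E M r :=
  iotas (n + 1) v (Form.d α) - ∑ i : Fin (n + 1), (-1 : ℝ) ^ (i : ℕ) •
    iotas n (i.removeNth v) (lieDerivative (v i) (r + n) α) - bracketSum n v α

lemma iota_d {k : ℕ} (u : VF E M) (α : Form E M (k + 1)) :
    iota u (Form.d α) = lieDerivative u (k + 1) α - Form.d (iota u α) :=
  (add_sub_cancel_left (Form.d (iota u α)) (iota u (Form.d α))).symm

lemma iota_lieDerivative {k : ℕ} (u w : VF E M) (α : Form E M (k + 1)) :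
    iota w (lieDerivative u (k + 1) α) = lieDerivative u k (iota w α) + iota ⁅w, u⁆ α := by
  rw [lieDerivative_iota, ← lie_skew u w, _root_.map_neg, LinearMap.neg_apply]
  exact (add_neg_cancel_right _ (iota ⁅w, u⁆ α)).symm.trans (add_right_comm _ _ _)

/-- Write `ι_{v₀} dα = L_{v₀} α - d ι_{v₀} α`. The Lie derivative cancels the summand of index `0`.
Moving `ι_{v₀}` past the other `L_{vᵢ}` produces brackets `[v₀, vᵢ]`, which cancel the pairs
containing `v₀`. The rest is the negative of the same expression for `ι_{v₀} α`. -/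
lemma cartanDefect_succ (n : ℕ) {r : ℕ} (v : Fin (n + 2) → VF E M) (α : Form E M (r + (n + 1))) :
    cartanDefect (n + 1) v α = -cartanDefect n (Fin.tail v) (iota (v 0) α) := by
  have h : ∀ i : Fin (n + 1), (-1 : ℝ) ^ (i.succ : ℕ) •
      iotas (n + 1) (i.succ.removeNth v) (lieDerivative (v i.succ) (r + (n + 1)) α) =
      -((-1 : ℝ) ^ (i : ℕ) • iotas n (i.removeNth (Fin.tail v))
          (lieDerivative (v i.succ) (r + n) (iota (v 0) α)) +
        (-1 : ℝ) ^ (i : ℕ) • iotas n (i.removeNth (Fin.tail v)) (iota ⁅v 0, v i.succ⁆ α)) := by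
    intro i
    have e : iota (v 0) (lieDerivative (v i.succ) (r + (n + 1)) α) = _ :=
      iota_lieDerivative (v i.succ) (v 0) α
    rw [removeNth_succ, iotas_cons, e, iotas_add, Fin.val_succ, pow_succ, mul_neg_one,
      Form.neg_smul, Form.smul_add]
    rfl
  unfold cartanDefect
  rw [bracketSum_succ, Fin.sum_univ_succ, Finset.sum_congr rfl fun i _ => h i,
    Finset.sum_neg_distrib, Finset.sum_add_distrib, iotas_succ]
  have e : iota (v 0) (Form.d α) = lieDerivative (v 0) (r + (n + 1)) α - _ := iota_d (v 0) α
  rw [e, iotas_sub, Fin.removeNth_zero]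
  simp only [Fin.val_zero, pow_zero, one_smul]
  change _ = -(_ - ∑ i : Fin (n + 1), (-1 : ℝ) ^ (i : ℕ) • iotas n (i.removeNth (Fin.tail v))
          (lieDerivative (v i.succ) (r + n) (iota (v 0) α)) - _)
  abel

/-- The recursion ends at a function, where `L_v = ι_v d` and the defect is zero. -/
lemma cartanDefect_zero : ∀ (n : ℕ) (v : Fin (n + 1) → VF E M) (α : Form E M (0 + n)),
    cartanDefect n v α = 0
  | 0, v, α => by
    have h : cartanDefect 0 v α = iota (v 0) (Form.d α) - ∑ i : Fin 1, (-1 : ℝ) ^ (i : ℕ) •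
      iota (v i) (Form.d α) - 0 := rfl
    rw [h]
    simp
  | n + 1, v, α => by rw [cartanDefect_succ, cartanDefect_zero n, neg_zero]

lemma iota_cast {p q : ℕ} (u : VF E M) (h : p = q) (h' : p + 1 = q + 1) (α : Form E M (p + 1)) :
    iota u (h' ▸ α : Form E M (q + 1)) = h ▸ iota u α := by
  subst h
  rfl

/-- The recursion ends at a form of positive degree, where `ι_v dα - L_v α = -d ι_v α`; each step
contributes another sign. The transport along `h` compares `r + 1 + n` with `r + (n + 1)`, which are
only propositionally equal. -/
lemma cartanDefect_pos : ∀ (n : ℕ) {r : ℕ} (v : Fin (n + 1) → VF E M) (α : Form E M (r + 1 + n))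
    (h : r + 1 + n = r + (n + 1)),
    cartanDefect n v α = (-1 : ℝ) ^ (n + 1) • Form.d (iotas (n + 1) v (h ▸ α))
  | 0, r, v, α, h => by
    have h : cartanDefect 0 v α = iota (v 0) (Form.d α) - ∑ i : Fin 1, (-1 : ℝ) ^ (i : ℕ) •
      lieDerivative (v i) (r + 1) α - 0 := rfl
    rw [h, iota_d]
    simp [Form.neg_smul]
    rfl
  | n + 1, r, v, α, h => by
    have h' : r + 1 + n = r + (n + 1) := by omega
    have e : iota (v 0) (h ▸ α : Form E M (r + (n + 1) + 1)) = _ := iota_cast (v 0) h' h α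
    rw [cartanDefect_succ, cartanDefect_pos n _ _ h', iotas_succ v, e, pow_succ (-1 : ℝ) (n + 1),
      mul_neg_one, Form.neg_smul]

/-- The multi-contractions of a closed form with vector fields that preserve it. -/
lemma bracketSum_eq {n r : ℕ} {v : Fin (n + 1) → VF E M} {α : Form E M (r + n)}
    (h : Form.d α = 0) (hv : ∀ i, lieDerivative (v i) (r + n) α = 0) :
    bracketSum n v α = -cartanDefect n v α := by
  unfold cartanDefect
  simp [h, hv, iotas_zero, Form.smul_zero]

end Contractions

/-! ### Unshuffles with two leading entries, and their signs -/

section Unshuffles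

/-- The permutation that lists `i`, then `i.succAbove j`, and then the remaining indices in their
order. -/
def pairPerm {n : ℕ} (i : Fin (n + 2)) (j : Fin (n + 1)) : Equiv.Perm (Fin (n + 2)) :=
  i.cycleRange.symm * Equiv.Perm.decomposeFin.symm (0, j.cycleRange.symm)

variable {n : ℕ}

lemma pairPerm_zero (i : Fin (n + 2)) (j : Fin (n + 1)) : pairPerm i j 0 = i := by
  simp [pairPerm]

lemma pairPerm_one (i : Fin (n + 2)) (j : Fin (n + 1)) : pairPerm i j 1 = i.succAbove j := by
  rw [← Fin.succ_zero_eq_one]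
  simp only [pairPerm, Equiv.Perm.mul_apply, Equiv.Perm.decomposeFin_symm_apply_succ,
    Equiv.swap_self, Equiv.refl_apply, Fin.cycleRange_symm_zero, Fin.cycleRange_symm_succ]

lemma pairPerm_succ_succ (i : Fin (n + 2)) (j : Fin (n + 1)) (a : Fin n) :
    pairPerm i j a.succ.succ = i.succAbove (j.succAbove a) := by
  simp only [pairPerm, Equiv.Perm.mul_apply, Equiv.Perm.decomposeFin_symm_apply_succ,
    Equiv.swap_self, Equiv.refl_apply, Fin.cycleRange_symm_succ]

/-- The two cycles have signs `(-1)^i` and `(-1)^j`. Here `j` counts positions after `i` has been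
removed, so for `i ≤ j.castSucc` the second listed index is `j + 1`; this is the source of the shift
in the exponent. -/
lemma sign_pairPerm (i : Fin (n + 2)) (j : Fin (n + 1)) :
    Equiv.Perm.sign (pairPerm i j) = (-1) ^ (i + j : ℕ) := by
  simp [pairPerm, Equiv.Perm.sign_mul, pow_add]

lemma isUnshuffle_two_iff {σ : Equiv.Perm (Fin (n + 2))} :
    IsUnshuffle 2 σ ↔ σ 0 < σ 1 ∧ StrictMono fun a : Fin n => σ a.succ.succ := by
  constructor
  · intro h
    exact ⟨h 0 1 (by simp) (Or.inl (by simp)), fun a b hab =>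
      h _ _ (by simpa using hab) (Or.inr (by simp))⟩
  · rintro ⟨h1, h2⟩ a b hab h
    induction a using Fin.cases with
    | zero =>
      induction b using Fin.cases with
      | zero => exact absurd hab (lt_irrefl _)
      | succ b =>
        induction b using Fin.cases with
        | zero => exact h1
        | succ b => simp at h
    | succ a =>
      induction b using Fin.cases with
      | zero => simp at hab
      | succ b =>
        induction a using Fin.cases with
        | zero =>
          induction b using Fin.cases with
          | zero => simp at hab
          | succ b => simp at h
        | succ a =>
          induction b using Fin.cases with
          | zero => simp at hab
          | succ b => exact h2 (by simpa using hab)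

lemma isUnshuffle_pairPerm {i : Fin (n + 2)} {j : Fin (n + 1)} (h : i ≤ j.castSucc) :
    IsUnshuffle 2 (pairPerm i j) := by
  rw [isUnshuffle_two_iff, pairPerm_zero, pairPerm_one]
  simp only [pairPerm_succ_succ]
  exact ⟨(Fin.lt_succAbove_iff_le_castSucc _ _).2 h,
    (Fin.strictMono_succAbove i).comp (Fin.strictMono_succAbove j)⟩

lemma range_perm_succ_succ (σ : Equiv.Perm (Fin (n + 2))) :
    range (fun a : Fin n => σ a.succ.succ) = {σ 0, σ 1}ᶜ := by
  ext y
  obtain ⟨b, rfl⟩ := σ.surjective y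
  simp only [mem_range, EmbeddingLike.apply_eq_iff_eq, mem_compl_iff, mem_insert_iff,
    mem_singleton_iff]
  induction b using Fin.cases with
  | zero => simp
  | succ b =>
    induction b using Fin.cases with
    | zero => simp [Fin.ext_iff]
    | succ b => simp [Fin.ext_iff]

/-- The first two values determine an unshuffle: the remaining values are listed increasingly, and
strictly monotone maps with equal range coincide. -/
lemma IsUnshuffle.eq_pairPerm {σ : Equiv.Perm (Fin (n + 2))} (h : IsUnshuffle 2 σ) :
    ∃ i j, i ≤ Fin.castSucc j ∧ pairPerm i j = σ := by
  have h01 := (isUnshuffle_two_iff.1 h).1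
  obtain ⟨j, hj⟩ := Fin.exists_succAbove_eq h01.ne'
  have hij : σ 0 ≤ j.castSucc := by rwa [← Fin.lt_succAbove_iff_le_castSucc, hj]
  refine ⟨σ 0, j, hij, ?_⟩
  have e0 := pairPerm_zero (σ 0) j
  have e1 := (pairPerm_one (σ 0) j).trans hj
  have hr : range (fun a : Fin n => pairPerm (σ 0) j a.succ.succ) =
      range (fun a : Fin n => σ a.succ.succ) := by
    rw [range_perm_succ_succ, range_perm_succ_succ, e0, e1]
  have hf := (StrictMono.range_inj (isUnshuffle_two_iff.1 (isUnshuffle_pairPerm hij)).2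
    (isUnshuffle_two_iff.1 h).2).1 hr
  ext1 b
  induction b using Fin.cases with
  | zero => exact e0
  | succ b =>
    induction b using Fin.cases with
    | zero => exact e1
    | succ b => exact congrFun hf b

lemma sum_unshuffle_two {A : Type*} [AddCommMonoid A] (f : Equiv.Perm (Fin (n + 2)) → A) :
    ∑ σ : Equiv.Perm (Fin (n + 2)) with IsUnshuffle 2 σ, f σ =
      ∑ i : Fin (n + 2), ∑ j : Fin (n + 1), if i ≤ j.castSucc then f (pairPerm i j) else 0 := by
  rw [← Finset.sum_product', ← Finset.sum_filter]
  symm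
  refine Finset.sum_bij (fun p _ => pairPerm p.1 p.2) (fun p hp => ?_) (fun p _ q _ hpq => ?_)
    (fun σ hσ => ?_) fun _ _ => rfl
  · exact Finset.mem_filter.2 ⟨Finset.mem_univ _, isUnshuffle_pairPerm (Finset.mem_filter.1 hp).2⟩
  · have h0 : p.1 = q.1 := by rw [← pairPerm_zero p.1 p.2, hpq, pairPerm_zero]
    have h1 : p.1.succAbove p.2 = q.1.succAbove q.2 := by rw [← pairPerm_one, hpq, pairPerm_one]
    rw [← h0] at h1
    exact Prod.ext h0 (Fin.succAbove_right_injective h1)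
  · obtain ⟨i, j, hij, rfl⟩ := (Finset.mem_filter.1 hσ).2.eq_pairPerm
    exact ⟨(i, j), Finset.mem_filter.2 ⟨by simp, hij⟩, rfl⟩

lemma isUnshuffle_self_iff {k : ℕ} {σ : Equiv.Perm (Fin k)} : IsUnshuffle k σ ↔ σ = 1 := by
  constructor
  · intro h
    have hm : StrictMono σ := fun a b hab => h a b hab (Or.inl b.2)
    ext1 a
    have := (StrictMono.range_inj hm strictMono_id).1 (by rw [σ.surjective.range_eq, range_id])
    exact congrFun this a
  · rintro rfl a b hab _
    exact hab

lemma koszulSign_one {k : ℕ} (d : Fin k → ℤ) : koszulSign d 1 = 1 := by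
  unfold koszulSign
  rw [Equiv.Perm.sign_one, one_mul]
  refine Finset.prod_eq_one fun p hp => ?_
  have h := (Finset.mem_filter.1 hp).2
  exact absurd h.1 (not_lt.2 h.2.le)

/-- In the situation of the observables a term is zero unless all degrees are zero, and then the
Koszul factors are trivial. -/
lemma koszulSign_smul {k : ℕ} {A : Type*} [AddCommGroup A] {d : Fin k → ℤ} {y : A}
    (h : ∀ i, d i ≠ 0 → y = 0) (σ : Equiv.Perm (Fin k)) :
    koszulSign d σ • y = Equiv.Perm.sign σ • y := by
  by_cases hd : ∃ i, d i ≠ 0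
  · obtain ⟨i, hi⟩ := hd
    rw [h i hi, smul_zero, smul_zero]
  · push Not at hd
    congr 1
    unfold koszulSign
    simp [hd]

end Unshuffles

/-! ### Gradings by projections, and restriction of the `L_∞` axioms to a subspace -/

section Generic

variable {L : Type*} [AddCommGroup L] [Module ℝ L]

/-- Projections onto the subspaces `𝒜 i` that add up to the identity. -/
structure IsGradedProjection (𝒜 : ℤ → Submodule ℝ L) (P : ℤ → L → L) (s : Finset ℤ) : Prop where
  mem : ∀ i x, P i x ∈ 𝒜 i
  sum_eq : ∀ x, ∑ i ∈ s, P i x = x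
  add : ∀ i x y, P i (x + y) = P i x + P i y
  self : ∀ i, ∀ x ∈ 𝒜 i, P i x = x
  of_ne : ∀ i j, i ≠ j → ∀ x ∈ 𝒜 i, P j x = 0

/-- The reason for describing the grading by projections: stability of `V` under them is all that is
needed for the grading to pass to `V`. -/
lemma IsGradedProjection.restrict {𝒜 : ℤ → Submodule ℝ L} {P : ℤ → L → L} {s : Finset ℤ}
    (h : IsGradedProjection 𝒜 P s) {V : Submodule ℝ L} (hV : ∀ i, ∀ x ∈ V, P i x ∈ V) :
    IsGradedProjection (fun i => (𝒜 i).comap V.subtype) (fun i x => ⟨P i x, hV i x x.2⟩) s where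
  mem i x := h.mem i x
  sum_eq x := Subtype.ext <| (AddSubmonoidClass.coe_finsetSum _ _).trans (h.sum_eq x)
  add i x y := Subtype.ext (h.add i x y)
  self i x hx := Subtype.ext (h.self i x hx)
  of_ne i j hij x hx := Subtype.ext (h.of_ne i j hij x hx)

/-- `P j` recovers the component of index `j` of a direct sum element from its image, which gives
injectivity; surjectivity is the decomposition `∑ P i x = x`. -/
lemma IsGradedProjection.isInternal {𝒜 : ℤ → Submodule ℝ L} {P : ℤ → L → L} {s : Finset ℤ}
    (h𝒜 : IsGradedProjection 𝒜 P s) : DirectSum.IsInternal 𝒜 := by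
  constructor
  · rw [injective_iff_map_eq_zero]
    intro f hf
    ext j
    have h : P j (DirectSum.coeAddMonoidHom 𝒜 f) = f j := by
      clear hf
      induction f using DirectSum.induction_on with
      | zero =>
        rw [_root_.map_zero]
        exact (h𝒜.self j 0 (zero_mem _))
      | of i x =>
        rw [DirectSum.coeAddMonoidHom_of]
        by_cases hij : i = j
        · subst hij
          rw [DirectSum.of_eq_same, h𝒜.self i x x.2]
        · rw [DirectSum.of_eq_of_ne _ _ _ (Ne.symm hij), h𝒜.of_ne i j hij x x.2]
          rfl
      | add f g hf hg =>
        rw [_root_.map_add, h𝒜.add, hf, hg]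
        rfl
    rw [← h, hf]
    exact h𝒜.self j 0 (zero_mem _)
  · intro x
    refine ⟨∑ i ∈ s, DirectSum.of (fun i => 𝒜 i) i ⟨P i x, h𝒜.mem i x⟩, ?_⟩
    rw [_root_.map_sum]
    simp only [DirectSum.coeAddMonoidHom_of]
    exact h𝒜.sum_eq x

lemma units_smul_eq (u : ℤˣ) (x : L) : u • x = ((u : ℤ) : ℝ) • x := by
  rw [Units.smul_def, Int.cast_smul_eq_zsmul]

/-- A subspace that is graded and closed under the multibrackets is an `L_∞`-subalgebra. -/
lemma IsLInftyAlgebra.isLInftySubalgebra {𝒜 : ℤ → Submodule ℝ L} {l : ∀ k, (Fin k → L) → L}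
    (h : IsLInftyAlgebra 𝒜 l) {V : Submodule ℝ L}
    (hV : DirectSum.IsInternal fun i => (𝒜 i).comap V.subtype)
    (hl : ∀ k, 1 ≤ k → ∀ x : Fin k → L, (∀ i, x i ∈ V) → l k x ∈ V) :
    IsLInftySubalgebra 𝒜 l V := by
  classical
  -- Closure is assumed only for positive arity; in arity zero no axiom applies and the value is
  -- arbitrary.
  let μ : ∀ k, (Fin k → V) → V := fun k x =>
    if hk : 1 ≤ k then ⟨l k fun i => x i, hl k hk _ fun i => (x i).2⟩ else 0
  have hμ : ∀ k, 1 ≤ k → ∀ x : Fin k → V, (μ k x : L) = l k fun i => x i := fun k hk x => by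
    simp only [μ, dif_pos hk]
  refine ⟨h, μ, ⟨hV, fun k hk => ?_, fun k hk d x hx => ?_, fun k hk d x hx σ => ?_,
    fun n d x hx => ?_⟩, hμ⟩
  · obtain ⟨f, hf⟩ := h.multilinear k hk
    refine ⟨(f.compLinearMap fun _ => V.subtype).codRestrict V fun x => ?_, fun x => ?_⟩
    · rw [MultilinearMap.compLinearMap_apply, hf]
      exact hl k hk _ fun i => (x i).2
    · refine Subtype.ext ?_
      rw [hμ k hk, ← hf]
      rfl
  · change (μ k x : L) ∈ 𝒜 (∑ i, d i + 2 - k)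
    rw [hμ k hk]
    exact h.degree k hk d _ hx
  · refine Subtype.ext ?_
    rw [hμ k hk]
    refine (h.skew k hk d (fun i => (x i : L)) hx σ).trans ?_
    rw [← hμ k hk, Units.smul_def, Units.smul_def]
    rfl
  · refine Subtype.ext ?_
    rw [AddSubmonoidClass.coe_finsetSum]
    refine Eq.trans (Finset.sum_congr rfl fun i _ => ?_) (h.jacobi n d (fun i => (x i : L)) hx)
    rw [AddSubmonoidClass.coe_finsetSum]
    refine Finset.sum_congr rfl fun σ _ => ?_
    rw [Units.smul_def, Units.smul_def]
    refine (_root_.map_zsmul V.subtype _ _).trans (congrArg _ ?_)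
    refine (hμ _ (Nat.succ_pos _) _).trans (congrArg _ (funext fun a => ?_))
    refine Fin.cases ?_ (fun a => rfl) a
    exact hμ _ (Nat.succ_pos _) _

end Generic

/-! ### Brackets that depend only on underlying vector fields -/

section FieldBrackets

variable {L V W : Type*} [AddCommGroup L] [Module ℝ L] [LieRing V] [Module ℝ V]
  [AddCommGroup W] [Module ℝ W]

lemma map_sum_pairs (g : W →ₗ[ℝ] L) {n : ℕ} (F : Fin (n + 2) → Fin (n + 1) → W) :
    g (∑ i : Fin (n + 2), ∑ j : Fin (n + 1), if i ≤ j.castSucc then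
      (-1 : ℝ) ^ (i + j : ℕ) • F i j else 0) =
    ∑ i : Fin (n + 2), ∑ j : Fin (n + 1), if i ≤ j.castSucc then
      (-1 : ℝ) ^ (i + j : ℕ) • g (F i j) else 0 := by
  simp only [_root_.map_sum, apply_ite g, _root_.map_smul, _root_.map_zero]

lemma fst_sum_pairs {n : ℕ} (F : Fin (n + 2) → Fin (n + 1) → L × W) :
    (∑ i : Fin (n + 2), ∑ j : Fin (n + 1), if i ≤ j.castSucc then
      (-1 : ℝ) ^ (i + j : ℕ) • F i j else 0).1 =
    ∑ i : Fin (n + 2), ∑ j : Fin (n + 1), if i ≤ j.castSucc then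
      (-1 : ℝ) ^ (i + j : ℕ) • (F i j).1 else 0 :=
  map_sum_pairs (LinearMap.fst ℝ L W) F

lemma snd_sum_pairs {n : ℕ} (F : Fin (n + 2) → Fin (n + 1) → W × L) :
    (∑ i : Fin (n + 2), ∑ j : Fin (n + 1), if i ≤ j.castSucc then
      (-1 : ℝ) ^ (i + j : ℕ) • F i j else 0).2 =
    ∑ i : Fin (n + 2), ∑ j : Fin (n + 1), if i ≤ j.castSucc then
      (-1 : ℝ) ^ (i + j : ℕ) • (F i j).2 else 0 :=
  map_sum_pairs (LinearMap.snd ℝ W L) F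

lemma apply_sum_pairs {ι : Type*} {U : ι → Type*} [∀ p, AddCommGroup (U p)] [∀ p, Module ℝ (U p)]
    {n : ℕ} (F : Fin (n + 2) → Fin (n + 1) → ∀ p, U p) (p : ι) :
    (∑ i : Fin (n + 2), ∑ j : Fin (n + 1), if i ≤ j.castSucc then
      (-1 : ℝ) ^ (i + j : ℕ) • F i j else 0) p =
    ∑ i : Fin (n + 2), ∑ j : Fin (n + 1), if i ≤ j.castSucc then
      (-1 : ℝ) ^ (i + j : ℕ) • F i j p else 0 :=
  map_sum_pairs (LinearMap.proj (R := ℝ) p) F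

lemma add_sum_pairs_eq_zero {ι : Type*} {U : ι → Type*} [∀ p, AddCommGroup (U p)]
    [∀ p, Module ℝ (U p)] {n : ℕ} (a : L × W × (∀ p, U p))
    (F : Fin (n + 2) → Fin (n + 1) → L × W × (∀ p, U p))
    (h1 : a.1 + (∑ i : Fin (n + 2), ∑ j : Fin (n + 1), if i ≤ j.castSucc then
      (-1 : ℝ) ^ (i + j : ℕ) • (F i j).1 else 0) = 0)
    (h2 : a.2.1 + (∑ i : Fin (n + 2), ∑ j : Fin (n + 1), if i ≤ j.castSucc then
      (-1 : ℝ) ^ (i + j : ℕ) • (F i j).2.1 else 0) = 0)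
    (h3 : ∀ p, a.2.2 p + (∑ i : Fin (n + 2), ∑ j : Fin (n + 1), if i ≤ j.castSucc then
      (-1 : ℝ) ^ (i + j : ℕ) • (F i j).2.2 p else 0) = 0) :
    a + (∑ i : Fin (n + 2), ∑ j : Fin (n + 1), if i ≤ j.castSucc then
      (-1 : ℝ) ^ (i + j : ℕ) • F i j else 0) = 0 := by
  refine Prod.ext ?_ (Prod.ext ?_ (funext fun p => ?_))
  · rw [Prod.fst_add, fst_sum_pairs, h1, Prod.fst_zero]
  · rw [Prod.snd_add, Prod.fst_add, snd_sum_pairs, fst_sum_pairs, h2]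
    rfl
  · rw [Prod.snd_add, Prod.snd_add, snd_sum_pairs, snd_sum_pairs, Pi.add_apply, apply_sum_pairs, h3]
    rfl

lemma jacobi_pairs {V : Type*} [LieRing V] [Module ℝ V] (v : Fin 3 → V) :
    (∑ i : Fin 3, ∑ j : Fin 2, if i ≤ j.castSucc then (-1 : ℝ) ^ (i + j : ℕ) •
      ⁅⁅v i, v (i.succAbove j)⁆, j.removeNth (i.removeNth v) 0⁆ else 0) = 0 := by
  have h := lie_jacobi (v 0) (v 1) (v 2)
  simp [Fin.sum_univ_succ, Fin.removeNth]
  rw [← lie_skew (v 2) (v 0), lie_neg] at *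
  rw [← lie_skew (v 2) (v 1), ← lie_skew (v 1) (v 0), lie_neg, lie_neg]
  -- Expanding each `[[a,b],c]` as `[a,[b,c]] - [b,[a,c]]` produces every term of the Jacobi
  -- identity twice.
  refine Eq.trans ?_ ((congrArg (fun t => t + t) h).trans (add_zero 0))
  abel

/-- Multibrackets that in arities at least two are determined by alternating maps `B` of the images
of the arguments under a linear map `fld` to a Lie ring. -/
structure IsFieldBracket (𝒜 : ℤ → Submodule ℝ L) (l : ∀ k, (Fin k → L) → L) (fld : L →ₗ[ℝ] V)
    (T : L →ₗ[ℝ] W) (B : ∀ k, V [⋀^Fin k]→ₗ[ℝ] W) (δ : L →ₗ[ℝ] L) : Prop where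
  injective : Function.Injective T
  apply_bracket : ∀ k x, T (l (k + 2) x) = B (k + 2) (fld ∘ x)
  unary : ∀ x, l 1 x = δ (x 0)
  field_eq_zero : ∀ d, d ≠ 0 → ∀ x ∈ 𝒜 d, fld x = 0
  unary_mem : ∀ d, ∀ x ∈ 𝒜 d, δ x ∈ 𝒜 (d + 1)
  bracket_mem : ∀ (k : ℕ) x, l (k + 2) x ∈ 𝒜 (-k)
  unary_unary : ∀ x, δ (δ x) = 0
  unary_binary : ∀ x, δ (l 2 x) = 0
  field_unary : ∀ x, fld (δ x) = 0
  field_binary : ∀ x, fld (l 2 x) = ⁅fld (x 0), fld (x 1)⁆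
  field_bracket : ∀ k x, fld (l (k + 3) x) = 0
  unary_bracket : ∀ (n : ℕ) (x : Fin (n + 3) → L), T (δ (l (n + 3) x)) +
    (∑ i : Fin (n + 3), ∑ j : Fin (n + 2), if i ≤ j.castSucc then (-1 : ℝ) ^ (i + j : ℕ) •
      B (n + 2) (Fin.cons ⁅fld (x i), fld (x (i.succAbove j))⁆
        (j.removeNth (i.removeNth (fld ∘ x))) : Fin (n + 2) → V) else 0) = 0

namespace IsFieldBracket

variable {𝒜 : ℤ → Submodule ℝ L} {l : ∀ k, (Fin k → L) → L} {fld : L →ₗ[ℝ] V} {T : L →ₗ[ℝ] W}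
  {B : ∀ k, V [⋀^Fin k]→ₗ[ℝ] W} {δ : L →ₗ[ℝ] L}

lemma unary' (h : IsFieldBracket 𝒜 l fld T B δ) {k : ℕ} (hk : k = 1) (x : Fin k → L) :
    l k x = δ (x ⟨0, by omega⟩) := by
  subst hk
  exact h.unary x

/-- Covers both arguments of nonzero degree and arguments that are themselves brackets without a
vector field. This is what removes most terms from the higher Jacobi relations. -/
lemma bracket_eq_zero (h : IsFieldBracket 𝒜 l fld T B δ) {k : ℕ} (hk : 2 ≤ k) {x : Fin k → L}
    (i : Fin k) (hi : fld (x i) = 0) : l k x = 0 := by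
  obtain ⟨k, rfl⟩ := Nat.exists_eq_add_of_le' hk
  refine h.injective ?_
  rw [h.apply_bracket, _root_.map_zero]
  exact AlternatingMap.map_coord_zero _ i hi

lemma field_bracket' (h : IsFieldBracket 𝒜 l fld T B δ) : ∀ {k : ℕ}, 1 ≤ k → k ≠ 2 →
    ∀ x : Fin k → L, fld (l k x) = 0
  | 1, _, _, x => by rw [h.unary, h.field_unary]
  | 2, _, h2, _ => absurd rfl h2
  | k + 3, _, _, x => h.field_bracket k x

lemma multilinear (h : IsFieldBracket 𝒜 l fld T B δ) : ∀ k, 1 ≤ k →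
    ∃ f : MultilinearMap ℝ (fun _ : Fin k => L) L, ∀ x, f x = l k x
  | 1, _ => ⟨MultilinearMap.ofSubsingleton ℝ L L 0 δ, fun x => (h.unary x).symm⟩
  | k + 2, _ => by
    refine ⟨{ toFun := l (k + 2), map_update_add' := ?_, map_update_smul' := ?_ }, fun _ => rfl⟩
    · intro inst x i a b
      refine h.injective ?_
      rw [_root_.map_add]
      simp only [h.apply_bracket, Function.comp_update, _root_.map_add]
      exact (B (k + 2)).map_update_add _ _ _ _
    · intro inst x i c a
      refine h.injective ?_
      rw [_root_.map_smul]
      simp only [h.apply_bracket, Function.comp_update, _root_.map_smul]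
      exact (B (k + 2)).map_update_smul _ _ _ _

lemma degree (h : IsFieldBracket 𝒜 l fld T B δ) : ∀ k, 1 ≤ k → ∀ (d : Fin k → ℤ) (x : Fin k → L),
    (∀ i, x i ∈ 𝒜 (d i)) → l k x ∈ 𝒜 (∑ i, d i + 2 - k)
  | 1, _, d, x, hx => by
    rw [Fin.sum_univ_one, h.unary, show d 0 + 2 - ((1 : ℕ) : ℤ) = d 0 + 1 by push_cast; ring]
    exact h.unary_mem _ _ (hx 0)
  | k + 2, _, d, x, hx => by
    by_cases hd : ∃ i, d i ≠ 0
    · obtain ⟨i, hi⟩ := hd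
      rw [h.bracket_eq_zero (by omega) i (h.field_eq_zero _ hi _ (hx i))]
      exact zero_mem _
    · push Not at hd
      rw [show ∑ i, d i + 2 - ((k + 2 : ℕ) : ℤ) = -k by simp [hd]]
      exact h.bracket_mem k x

lemma skew (h : IsFieldBracket 𝒜 l fld T B δ) : ∀ k, 1 ≤ k → ∀ (d : Fin k → ℤ) (x : Fin k → L),
    (∀ i, x i ∈ 𝒜 (d i)) → ∀ σ : Equiv.Perm (Fin k), l k (x ∘ σ) = koszulSign d σ • l k x
  | 1, _, d, x, hx, σ => by
    rw [Subsingleton.elim σ 1, koszulSign_one, one_smul]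
    rfl
  | k + 2, _, d, x, hx, σ => by
    rw [koszulSign_smul fun i hi => h.bracket_eq_zero (by omega) i (h.field_eq_zero _ hi _ (hx i)),
      units_smul_eq]
    refine h.injective ?_
    rw [_root_.map_smul, h.apply_bracket, h.apply_bracket, ← units_smul_eq, ← AlternatingMap.map_perm]
    rfl

/-- Turns the sum over unshuffles with a binary bracket inside into the sum over pairs of indices in
which the iterated Cartan formula is written. -/
lemma sum_binary (h : IsFieldBracket 𝒜 l fld T B δ) {n : ℕ} (d : Fin (n + 3) → ℤ)
    (x : Fin (n + 3) → L) (hx : ∀ i, x i ∈ 𝒜 (d i)) :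
    T (∑ σ : Equiv.Perm (Fin (n + 3)) with IsUnshuffle 2 σ,
      (koszulSign d σ * (-1) ^ (2 * (n + 1))) • l (n + 2) (Fin.cons (l 2 fun a => x (σ ⟨a, by omega⟩))
        fun b => x (σ ⟨2 + b, by omega⟩))) =
    ∑ i : Fin (n + 3), ∑ j : Fin (n + 2), if i ≤ j.castSucc then (-1 : ℝ) ^ (i + j : ℕ) •
      B (n + 2) (Fin.cons ⁅fld (x i), fld (x (i.succAbove j))⁆
        (j.removeNth (i.removeNth (fld ∘ x))) : Fin (n + 2) → V) else 0 := by
  rw [sum_unshuffle_two, _root_.map_sum]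
  refine Finset.sum_congr rfl fun i _ => ?_
  rw [_root_.map_sum]
  refine Finset.sum_congr rfl fun j _ => ?_
  split_ifs with hij
  · set σ := pairPerm i j
    have e : (fun b : Fin (n + 1) => x (σ ⟨2 + b, by omega⟩)) = j.removeNth (i.removeNth x) := by
      funext b
      have hb : (⟨2 + b, by omega⟩ : Fin (n + 3)) = b.succ.succ := Fin.ext (by simp; omega)
      rw [hb]
      exact congrArg x (pairPerm_succ_succ i j b)
    -- An argument of nonzero degree has no field. It kills the inner bracket if it is one of the
    -- first two, and the outer bracket otherwise, so only the ordinary sign of `σ` matters.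
    have hz : ∀ t, d t ≠ 0 → l (n + 2) (Fin.cons (l 2 fun a => x (σ ⟨a, by omega⟩))
        fun b => x (σ ⟨2 + b, by omega⟩)) = 0 := by
      intro t ht
      have hf := h.field_eq_zero _ ht _ (hx t)
      obtain ⟨s, rfl⟩ := σ.surjective t
      by_cases hs : (s : ℕ) < 2
      · refine h.bracket_eq_zero (by omega) 0 ?_
        rw [Fin.cons_zero, h.bracket_eq_zero le_rfl ⟨s, hs⟩ hf, _root_.map_zero]
      · refine h.bracket_eq_zero (by omega) (Fin.succ ⟨s - 2, by omega⟩) ?_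
        rw [Fin.cons_succ]
        have hb : (⟨2 + (s - 2), by omega⟩ : Fin (n + 3)) = s := Fin.ext (by simp; omega)
        simp only [hb]
        exact hf
    rw [pow_mul, neg_one_sq, one_pow, mul_one, koszulSign_smul hz, units_smul_eq, _root_.map_smul,
      h.apply_bracket, sign_pairPerm, e]
    push_cast
    congr 2
    refine (Fin.comp_cons _ _ _).trans ?_
    rw [h.field_binary]
    have e0 : σ 0 = i := pairPerm_zero i j
    have e1 : σ 1 = i.succAbove j := pairPerm_one i j
    change (Fin.cons ⁅fld (x (σ 0)), fld (x (σ 1))⁆ _ : Fin (n + 2) → V) = _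
    rw [e0, e1]
    rfl
  · exact _root_.map_zero T

/-- If the outer bracket is not unary, its first argument must have a nonzero field, so the inner
bracket is binary. With one or two arguments every term vanishes separately; from three on, the two
surviving kinds of terms cancel by `unary_bracket`. -/
lemma jacobi (h : IsFieldBracket 𝒜 l fld T B δ) : ∀ (n : ℕ) (d : Fin (n + 1) → ℤ)
    (x : Fin (n + 1) → L), (∀ i, x i ∈ 𝒜 (d i)) →
    ∑ i : Fin (n + 1), ∑ σ : Equiv.Perm (Fin (n + 1)) with IsUnshuffle (i + 1) σ,
      (koszulSign d σ * (-1) ^ ((i + 1) * (n - i) : ℕ)) •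
        l (n - i + 1) (Fin.cons
          (l (i + 1) fun a => x (σ ⟨a, by omega⟩))
          fun b => x (σ ⟨i + 1 + b, by omega⟩)) = 0
  | 0, d, x, hx => by
    refine Finset.sum_eq_zero fun i _ => Finset.sum_eq_zero fun σ _ => ?_
    have hi : (i : ℕ) = 0 := by omega
    rw [h.unary' (by omega)]
    refine (congrArg _ ?_).trans (smul_zero _)
    change δ (l (i + 1) _) = 0
    rw [h.unary' (by omega), h.unary_unary]
  | 1, d, x, hx => by
    refine Finset.sum_eq_zero fun i _ => Finset.sum_eq_zero fun σ _ => ?_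
    refine (congrArg _ ?_).trans (smul_zero _)
    fin_cases i
    · refine h.bracket_eq_zero le_rfl 0 ?_
      rw [Fin.cons_zero]
      exact h.field_bracket' le_rfl (by simp) _
    · refine (h.unary _).trans ?_
      rw [Fin.cons_zero]
      exact h.unary_binary _
  | n + 2, d, x, hx => by
    -- The index is the inner arity minus one: `1` stands for a binary bracket inside, the last
    -- index for the unary bracket outside.
    rw [Finset.sum_eq_add (⟨1, by omega⟩ : Fin (n + 3)) (Fin.last (n + 2)) (by simp [Fin.ext_iff])]
    · refine h.injective ?_
      rw [_root_.map_add, _root_.map_zero, add_comm, ← h.unary_bracket n x]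
      congr 1
      · refine congrArg T ?_
        -- When the inner bracket takes all arguments, the identity is the only unshuffle.
        rw [Finset.sum_eq_single 1]
        · have he : ((Fin.last (n + 2) : ℕ) + 1) * (n + 2 - (Fin.last (n + 2) : ℕ)) = 0 := by simp
          rw [koszulSign_one, h.unary' (by simp), one_mul, he, pow_zero, one_smul]
          rfl
        · intro σ hσ hne
          exact absurd (isUnshuffle_self_iff.1 (Finset.mem_filter.1 hσ).2) hne
        · intro hne
          exact absurd (Finset.mem_filter.2 ⟨Finset.mem_univ _, isUnshuffle_self_iff.2 rfl⟩) hne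
      · exact h.sum_binary d x hx
    · rintro c - ⟨hc1, hc2⟩
      refine Finset.sum_eq_zero fun σ _ => (congrArg _ ?_).trans (smul_zero _)
      have h1 : (c : ℕ) ≠ 1 := fun hc => hc1 (Fin.ext hc)
      have h2 : (c : ℕ) ≠ n + 2 := fun hc => hc2 (Fin.ext hc)
      refine h.bracket_eq_zero (by omega) 0 ?_
      rw [Fin.cons_zero]
      exact h.field_bracket' (by omega) (by omega) _
    · intro hne
      exact absurd (Finset.mem_univ _) hne
    · intro hne
      exact absurd (Finset.mem_univ _) hne

/-- A subspace that is graded and closed under the multibrackets is an `L_∞`-subalgebra. -/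
theorem isLInftySubalgebra (h : IsFieldBracket 𝒜 l fld T B δ) {P : ℤ → L → L} {s : Finset ℤ}
    (hP : IsGradedProjection 𝒜 P s) {U : Submodule ℝ L} (hU : ∀ i, ∀ x ∈ U, P i x ∈ U)
    (hl : ∀ k, 1 ≤ k → ∀ x : Fin k → L, (∀ i, x i ∈ U) → l k x ∈ U) :
    IsLInftySubalgebra 𝒜 l U :=
  IsLInftyAlgebra.isLInftySubalgebra ⟨hP.isInternal, h.multilinear, h.degree, h.skew, h.jacobi⟩
    (hP.restrict hU).isInternal hl

end IsFieldBracket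

end FieldBrackets

/-! ### Multicontractions of `ω` with Hamiltonian fields -/

section Observables

variable {E : Type*} [NormedAddCommGroup E] [NormedSpace ℝ E] [FiniteDimensional ℝ E]
  {M : Type*} [TopologicalSpace M] [ChartedSpace E M] [IsManifold 𝓘(ℝ, E) ∞ M] {m : ℕ}
  {Ω : PrePlectic E M m}

/-- The vector field of the component of degree `0`. -/
def Ham.field (x : Ham Ω) : VF E M := x.1.1.1

/-- The form `ς(k) ι(v₁ ∧ ⋯ ∧ v_k) ω`, if it has degree `p`. -/
def multiContraction (Ω : PrePlectic E M m) (k p : ℕ) (v : Fin k → VF E M) : Form E M p :=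
  if h : m + 2 = p + k then totalSign k • iotas k v (h ▸ Ω.form) else 0

/-- `multiContraction`, as an alternating map. -/
def multiContractionAlternating (Ω : PrePlectic E M m) (k p : ℕ) :
    VF E M [⋀^Fin k]→ₗ[ℝ] Form E M p :=
  if h : m + 2 = p + k then totalSign k • iotasAlternating k (h ▸ Ω.form) else 0

lemma multiContractionAlternating_apply (k p : ℕ) (v : Fin k → VF E M) :
    multiContractionAlternating Ω k p v = multiContraction Ω k p v := by
  unfold multiContractionAlternating multiContraction
  split_ifs <;> rfl

lemma multiContraction_of_ne {k p : ℕ} (h : m + 2 ≠ p + k) (v : Fin k → VF E M) :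
    multiContraction Ω k p v = 0 := dif_neg h

lemma multiContraction_of_eq {k p : ℕ} (h : m + 2 = p + k) (v : Fin k → VF E M) :
    multiContraction Ω k p v = totalSign k • iotas k v (h ▸ Ω.form) := dif_pos h

lemma Ham.ext_iff' {x y : Ham Ω} : x = y ↔ x.field = y.field ∧ x.1.1.2 = y.1.1.2 ∧
    ∀ p, x.2 p = y.2 p :=
  ⟨fun h => by subst h; exact ⟨rfl, rfl, fun _ => rfl⟩, fun h =>
    Prod.ext (Subtype.ext (Prod.ext h.1 h.2.1)) (funext h.2.2)⟩

lemma d_cast {p q : ℕ} (h : p = q) {α : Form E M p} (hα : Form.d α = 0) :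
    Form.d (h ▸ α : Form E M q) = 0 := by
  subst h
  exact hα

lemma cast_cast_form {p q r : ℕ} (h : p = q) (h' : q = r) (h'' : p = r) (α : Form E M p) :
    (h' ▸ (h ▸ α : Form E M q) : Form E M r) = h'' ▸ α := by
  subst h h'
  rfl

/-- Supplies the invariance of `ω` under Hamiltonian fields, which removes the Lie derivative terms
from the iterated Cartan formula. -/
lemma lieDerivative_eq_zero : ∀ {k : ℕ} {v : VF E M} {α : Form E M (k + 1)}, Form.d α = 0 →
    Form.d (iota v α) = 0 → lieDerivative v (k + 1) α = 0 := by
  intro k v α h hv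
  change Form.d (iota v α) + iota v (Form.d α) = 0
  rw [h, hv, _root_.map_zero, add_zero]

lemma lieDerivative_cast {p q : ℕ} (h : p = q) {v : VF E M} {α : Form E M p}
    (hα : lieDerivative v p α = 0) : lieDerivative v q (h ▸ α : Form E M q) = 0 := by
  subst h
  exact hα

lemma Ham.d_iota_field (x : Ham Ω) : Form.d (iota x.field Ω.form) = 0 := by
  have h : Form.d x.1.1.2 = -iota x.field Ω.form := x.1.2
  rw [← neg_neg (iota x.field Ω.form), ← h, _root_.map_neg, Form.d_d, neg_zero]

/-- Consecutive triangular numbers differ by `k + 1`. This ratio is exactly the sign in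
`cartanDefect_pos`. -/
lemma totalSign_succ (k : ℕ) : totalSign (k + 1) = totalSign k * (-1) ^ (k + 1) := by
  have h : (k + 1) * (k + 1 + 1) / 2 = k * (k + 1) / 2 + (k + 1) := by
    rw [← Nat.add_mul_div_left _ _ two_pos]
    ring_nf
  rw [totalSign, totalSign, h, pow_add, neg_mul]

lemma sum_multiContraction {n p : ℕ} (h : m + 2 = p + (n + 1)) (v : Fin (n + 2) → VF E M) :
    (∑ i : Fin (n + 2), ∑ j : Fin (n + 1), if i ≤ j.castSucc then
      (-1 : ℝ) ^ (i + j : ℕ) • multiContraction Ω (n + 1) p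
        (Fin.cons ⁅v i, v (i.succAbove j)⁆ (j.removeNth (i.removeNth v)) : Fin (n + 1) → VF E M)
      else 0) = totalSign (n + 1) • bracketSum (n + 1) v (h ▸ Ω.form) := by
  rw [bracketSum, Finset.smul_sum]
  refine Finset.sum_congr rfl fun i _ => ?_
  rw [Finset.smul_sum]
  refine Finset.sum_congr rfl fun j _ => ?_
  split_ifs
  · rw [multiContraction_of_eq h]
    exact smul_comm (α := Form E M p) _ _ _
  · exact (Form.smul_zero _).symm

/-- The exterior derivative of `multiContraction`, in degree `p`. -/
def dMultiContraction (Ω : PrePlectic E M m) (k : ℕ) : ∀ p, (Fin k → VF E M) → Form E M p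
  | 0, _ => 0
  | p + 1, v => Form.d (multiContraction Ω k p v)

/-- The form part of the higher Jacobi relation. Since `ω` is closed and preserved by the fields,
the sum over pairs is minus the Cartan defect up to the total sign. If the degrees do not match,
both terms are zero. -/
lemma dMultiContraction_add_sum (n : ℕ) : ∀ (p : ℕ) (v : Fin (n + 2) → VF E M),
    (∀ i, Form.d (iota (v i) Ω.form) = 0) → dMultiContraction Ω (n + 2) p v +
    (∑ i : Fin (n + 2), ∑ j : Fin (n + 1), if i ≤ j.castSucc then
      (-1 : ℝ) ^ (i + j : ℕ) • multiContraction Ω (n + 1) p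
        (Fin.cons ⁅v i, v (i.succAbove j)⁆ (j.removeNth (i.removeNth v)) : Fin (n + 1) → VF E M)
      else 0) = 0 := by
  intro p v hv
  by_cases h : m + 2 = p + (n + 1)
  · rw [sum_multiContraction h, bracketSum_eq (d_cast h Ω.closed) fun i =>
      lieDerivative_cast h (lieDerivative_eq_zero Ω.closed (hv i))]
    cases p with
    | zero =>
      -- In form degree zero there is no exterior derivative to compensate, and the sum over pairs
      -- vanishes by itself.
      rw [cartanDefect_zero, neg_zero, dMultiContraction, zero_add]
      exact Form.smul_zero _
    | succ p =>
      have h1 : p + 1 + (n + 1) = p + (n + 1 + 1) := by omega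
      have h2 : m + 2 = p + (n + 2) := by omega
      have e : (h1 ▸ (h ▸ Ω.form : Form E M (p + 1 + (n + 1))) : Form E M (p + (n + 1 + 1))) =
          (h2 ▸ Ω.form : Form E M (p + (n + 2))) :=
        cast_cast_form h h1 h2 Ω.form
      rw [cartanDefect_pos (n + 1) v _ h1, e, dMultiContraction, multiContraction_of_eq h2,
        totalSign_succ (n + 1), _root_.map_smul, Form.smul_neg, mul_smul, ← sub_eq_add_neg]
      exact sub_self _
  · rw [Finset.sum_eq_zero fun i _ => Finset.sum_eq_zero fun j _ => ?_, add_zero]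
    · cases p with
      | zero => rfl
      | succ p =>
        rw [dMultiContraction, multiContraction_of_ne (by omega), _root_.map_zero]
    · rw [multiContraction_of_ne h]
      split_ifs
      · exact Form.smul_zero _
      · rfl

end Observables

/-! ### The brackets of observables as alternating maps, and the grading -/

section Brackets

variable {E : Type*} [NormedAddCommGroup E] [NormedSpace ℝ E] [FiniteDimensional ℝ E]
  {M : Type*} [TopologicalSpace M] [ChartedSpace E M] [IsManifold 𝓘(ℝ, E) ∞ M] {m : ℕ}
  {Ω : PrePlectic E M m}

/-- The Lie bracket of vector fields, as an alternating map. -/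
def lieAlternating : VF E M [⋀^Fin 2]→ₗ[ℝ] VF E M where
  toFun v := ⁅v 0, v 1⁆
  map_update_add' {inst} v i a b := by
    rw [Subsingleton.elim inst (instDecidableEqFin 2)]
    fin_cases i <;> simp
  map_update_smul' {inst} v i c a := by
    rw [Subsingleton.elim inst (instDecidableEqFin 2)]
    fin_cases i <;> simp
  map_eq_zero_of_eq' v i j h hij := by
    fin_cases i <;> fin_cases j <;> simp_all

/-- The vector field of the `k`-ary bracket, for `k ≥ 2`. -/
def bracketField : ∀ k, VF E M [⋀^Fin k]→ₗ[ℝ] VF E M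
  | 2 => lieAlternating
  | _ => 0

lemma Ham.bracket_field : ∀ (k : ℕ) (x : Fin (k + 2) → Ham Ω),
    (Ham.bracket Ω (k + 2) x).field = bracketField (k + 2) (Ham.field ∘ x)
  | 0, _ => rfl
  | _ + 1, _ => rfl

lemma Ham.bracket_form : ∀ (k : ℕ) (x : Fin (k + 2) → Ham Ω),
    (Ham.bracket Ω (k + 2) x).1.1.2 = multiContractionAlternating Ω (k + 2) m (Ham.field ∘ x)
  | 0, x => by
    have h : Ham.field ∘ x = ![(x 0).field, (x 1).field] := by
      funext i
      fin_cases i <;> rfl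
    rw [multiContractionAlternating_apply, multiContraction_of_eq rfl, h]
    rfl
  | k + 1, x => by
    -- From arity three on the contraction has form degree below `m`, so it lands in negative
    -- degree.
    rw [multiContractionAlternating_apply, multiContraction_of_ne (by omega)]
    rfl

lemma Ham.bracket_component : ∀ (k : ℕ) (x : Fin (k + 2) → Ham Ω) (p : Fin m),
    (Ham.bracket Ω (k + 2) x).2 p = multiContractionAlternating Ω (k + 2) p (Ham.field ∘ x)
  | 0, x, p => by
    have hp := p.2
    rw [multiContractionAlternating_apply, multiContraction_of_ne (by omega)]
    rfl
  | k + 1, x, p => by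
    rw [multiContractionAlternating_apply]
    rfl

/-- The triple of the vector field, the form that belongs to it, and the forms of negative degree. -/
def Ham.triple (Ω : PrePlectic E M m) :
    Ham Ω →ₗ[ℝ] VF E M × Form E M m × (∀ p : Fin m, Form E M p) where
  toFun x := (x.1.1.1, x.1.1.2, x.2)
  map_add' _ _ := rfl
  map_smul' _ _ := rfl

/-- The alternating maps are defined on arbitrary vector fields, whose contractions need not satisfy
`dα = -ι_v ω`. So identities are checked in the unconstrained product and brought back by
injectivity. -/
lemma Ham.triple_injective : Function.Injective (Ham.triple Ω) := fun _ _ h =>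
  have h' := Prod.ext_iff.1 h
  have h'' := Prod.ext_iff.1 h'.2
  Ham.ext_iff'.2 ⟨h'.1, h''.1, fun p => congrFun h''.2 p⟩

/-- The brackets of arity at least two, as alternating maps of the vector fields. -/
def Ham.bracketAlternating (Ω : PrePlectic E M m) (k : ℕ) :
    VF E M [⋀^Fin k]→ₗ[ℝ] (VF E M × Form E M m × (∀ p : Fin m, Form E M p)) :=
  (bracketField k).prod ((multiContractionAlternating Ω k m).prod
    (AlternatingMap.pi fun p => multiContractionAlternating Ω k p))

lemma Ham.triple_bracket (k : ℕ) (x : Fin (k + 2) → Ham Ω) :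
    Ham.triple Ω (Ham.bracket Ω (k + 2) x) = Ham.bracketAlternating Ω (k + 2) (Ham.field ∘ x) :=
  Prod.ext (Ham.bracket_field k x) (Prod.ext (Ham.bracket_form k x)
    (funext fun p => Ham.bracket_component k x p))

lemma Ham.field_eq_zero {x : Ham Ω} {d : ℤ} (hx : x ∈ Ham.degree Ω d) (hd : d ≠ 0) :
    x.field = 0 := by
  rw [Ham.field, hx.1 hd]
  rfl

lemma Ham.dForm_add (x y : Ham Ω) : ∀ p, (x + y).dForm p = x.dForm p + y.dForm p
  | 0 => (add_zero (0 : Form E M 0)).symm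
  | p + 1 => by
    simp only [Ham.dForm]
    split_ifs
    · exact _root_.map_add _ _ _
    · exact (add_zero (0 : Form E M (p + 1))).symm

lemma Ham.dForm_smul (c : ℝ) (x : Ham Ω) : ∀ p, (c • x).dForm p = c • x.dForm p
  | 0 => (Form.smul_zero c).symm
  | p + 1 => by
    simp only [Ham.dForm]
    split_ifs
    · exact _root_.map_smul Form.d _ _
    · exact (Form.smul_zero c).symm

/-- The unary bracket, as a linear map. -/
def Ham.bracketLinear (Ω : PrePlectic E M m) : Ham Ω →ₗ[ℝ] Ham Ω where
  toFun x := x.bracket₁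
  map_add' x y := Ham.ext_iff'.2 ⟨(add_zero (0 : VF E M)).symm, Ham.dForm_add x y m,
    fun p => Ham.dForm_add x y p⟩
  map_smul' c x := Ham.ext_iff'.2 ⟨(_root_.smul_zero (A := VF E M) c).symm, Ham.dForm_smul c x m,
    fun p => Ham.dForm_smul c x p⟩

lemma Ham.dForm_eq_zero {x : Ham Ω} {d : ℤ} (hx : x ∈ Ham.degree Ω d) : ∀ {p : ℕ},
    d ≠ (p : ℤ) - 1 - m → x.dForm p = 0
  | 0, _ => rfl
  | p + 1, h => by
    simp only [Ham.dForm]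
    split_ifs with hp
    · rw [hx.2 ⟨p, hp⟩ (by push_cast at h; simpa using h), _root_.map_zero]
    · rfl

lemma Ham.bracket₁_mem_degree {d : ℤ} {x : Ham Ω} (hx : x ∈ Ham.degree Ω d) :
    x.bracket₁ ∈ Ham.degree Ω (d + 1) :=
  ⟨fun h => Subtype.ext (Prod.ext rfl (Ham.dForm_eq_zero hx (by omega))),
    fun _ h => Ham.dForm_eq_zero hx (by omega)⟩

lemma Ham.bracket_mem_degree (k : ℕ) (x : Fin (k + 2) → Ham Ω) :
    Ham.bracket Ω (k + 2) x ∈ Ham.degree Ω (-k) := by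
  refine ⟨fun h => ?_, fun p h => ?_⟩
  · cases k with
    | zero => exact absurd rfl h
    | succ k => rfl
  · rw [Ham.bracket_component, multiContractionAlternating_apply,
      multiContraction_of_ne (by omega)]

/-- The component of degree `i`. -/
def Ham.projection (Ω : PrePlectic E M m) (i : ℤ) (x : Ham Ω) : Ham Ω :=
  (if i = 0 then x.1 else 0, fun p => if i = (p : ℤ) - m then x.2 p else 0)

lemma Ham.projection_mem (i : ℤ) (x : Ham Ω) : Ham.projection Ω i x ∈ Ham.degree Ω i :=
  ⟨fun h => if_neg h, fun _ h => if_neg h⟩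

lemma Ham.projection_add (i : ℤ) (x y : Ham Ω) :
    Ham.projection Ω i (x + y) = Ham.projection Ω i x + Ham.projection Ω i y := by
  refine Prod.ext ?_ (funext fun p => ?_)
  · change (if i = 0 then x.1 + y.1 else 0) = (if i = 0 then x.1 else 0) + if i = 0 then y.1 else 0
    split_ifs
    · rfl
    · rw [add_zero]
  · change (if i = (p : ℤ) - m then x.2 p + y.2 p else 0) =
      (if i = (p : ℤ) - m then x.2 p else 0) + if i = (p : ℤ) - m then y.2 p else 0
    split_ifs
    · rfl
    · rw [add_zero]

lemma Ham.projection_self {i : ℤ} {x : Ham Ω} (hx : x ∈ Ham.degree Ω i) :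
    Ham.projection Ω i x = x := by
  refine Prod.ext ?_ (funext fun p => ?_)
  · change (if i = 0 then x.1 else 0) = x.1
    split_ifs with h
    · rfl
    · exact (hx.1 h).symm
  · change (if i = (p : ℤ) - m then x.2 p else 0) = x.2 p
    split_ifs with h
    · rfl
    · exact (hx.2 p h).symm

lemma Ham.projection_of_ne {i j : ℤ} (hij : i ≠ j) {x : Ham Ω} (hx : x ∈ Ham.degree Ω i) :
    Ham.projection Ω j x = 0 := by
  refine Prod.ext ?_ (funext fun p => ?_)
  · change (if j = 0 then x.1 else 0) = 0
    split_ifs with h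
    · exact hx.1 (h ▸ hij)
    · rfl
  · change (if j = (p : ℤ) - m then x.2 p else 0) = 0
    split_ifs with h
    · exact hx.2 p (h ▸ hij)
    · rfl

lemma Ham.sum_projection (x : Ham Ω) :
    ∑ i ∈ Finset.Icc (-m : ℤ) 0, Ham.projection Ω i x = x := by
  refine Prod.ext ?_ (funext fun p => ?_)
  · rw [Prod.fst_sum]
    change ∑ i ∈ Finset.Icc (-m : ℤ) 0, (if i = 0 then x.1 else 0) = x.1
    rw [Finset.sum_ite_eq', if_pos (by simp)]
  · rw [Prod.snd_sum, Finset.sum_apply]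
    change ∑ i ∈ Finset.Icc (-m : ℤ) 0, (if i = (p : ℤ) - m then x.2 p else 0) = x.2 p
    have hp := p.2
    rw [Finset.sum_ite_eq', if_pos (Finset.mem_Icc.2 (by omega))]

lemma Ham.isGradedProjection (Ω : PrePlectic E M m) :
    IsGradedProjection (Ham.degree Ω) (Ham.projection Ω) (Finset.Icc (-m : ℤ) 0) where
  mem := Ham.projection_mem
  sum_eq := Ham.sum_projection
  add := Ham.projection_add
  self _ _ := Ham.projection_self
  of_ne _ _ h _ := Ham.projection_of_ne h

end Brackets

/-! ### Verification of the higher Jacobi relations for observables -/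

section Main

variable {E : Type*} [NormedAddCommGroup E] [NormedSpace ℝ E] [FiniteDimensional ℝ E]
  {M : Type*} [TopologicalSpace M] [ChartedSpace E M] [IsManifold 𝓘(ℝ, E) ∞ M] {m : ℕ}
  {Ω : PrePlectic E M m}

/-- The vector field of the component of degree `0`, as a linear map. -/
def Ham.fieldLinear (Ω : PrePlectic E M m) : Ham Ω →ₗ[ℝ] VF E M where
  toFun x := x.field
  map_add' _ _ := rfl
  map_smul' _ _ := rfl

lemma Ham.dForm_bracket₁ (x : Ham Ω) : ∀ p, x.bracket₁.dForm p = 0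
  | 0 => rfl
  | p + 1 => by
    simp only [Ham.dForm]
    split_ifs
    · exact x.d_dForm p
    · rfl

lemma Ham.dForm_bracket₂ (x y : Ham Ω) : ∀ p, (x.bracket₂ y).dForm p = 0
  | 0 => rfl
  | p + 1 => by
    simp only [Ham.dForm]
    split_ifs
    · exact _root_.map_zero Form.d
    · rfl

/-- The component of form degree `p` of the unary bracket comes from degree `p - 1`, which belongs
to the negative part exactly because `p ≤ m`. -/
lemma Ham.dForm_bracket (k : ℕ) (x : Fin (k + 2) → Ham Ω) : ∀ p, p ≤ m →
    (Ham.bracket Ω (k + 2) x).dForm p = dMultiContraction Ω (k + 2) p (Ham.field ∘ x)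
  | 0, _ => rfl
  | p + 1, hp => by
    simp only [Ham.dForm]
    rw [dif_pos (show p < m by omega), Ham.bracket_component, multiContractionAlternating_apply]
    rfl

lemma Ham.dForm_add_sum (n : ℕ) (x : Fin (n + 3) → Ham Ω) {p : ℕ} (hp : p ≤ m) :
    (Ham.bracket Ω (n + 3) x).dForm p +
    (∑ i : Fin (n + 3), ∑ j : Fin (n + 2), if i ≤ j.castSucc then (-1 : ℝ) ^ (i + j : ℕ) •
      multiContractionAlternating Ω (n + 2) p (Fin.cons ⁅(x i).field, (x (i.succAbove j)).field⁆
        (j.removeNth (i.removeNth (Ham.field ∘ x))) : Fin (n + 2) → VF E M) else 0) = 0 := by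
  rw [Ham.dForm_bracket (n + 1) x p hp]
  simp only [multiContractionAlternating_apply]
  exact dMultiContraction_add_sum (n + 1) p (Ham.field ∘ x) fun i => (x i).d_iota_field

/-- With three arguments this is the Jacobi identity of vector fields; with more, the outer bracket
has arity at least three and no field. -/
lemma bracketField_add_sum : ∀ (n : ℕ) (v : Fin (n + 3) → VF E M),
    (∑ i : Fin (n + 3), ∑ j : Fin (n + 2), if i ≤ j.castSucc then (-1 : ℝ) ^ (i + j : ℕ) •
      bracketField (n + 2) (Fin.cons ⁅v i, v (i.succAbove j)⁆
        (j.removeNth (i.removeNth v)) : Fin (n + 2) → VF E M) else 0) = 0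
  | 0, v => jacobi_pairs v
  | n + 1, v => Finset.sum_eq_zero fun i _ => Finset.sum_eq_zero fun j _ => by
    split_ifs
    · exact _root_.smul_zero (A := VF E M) _
    · rfl

lemma Ham.triple_add_sum (n : ℕ) (x : Fin (n + 3) → Ham Ω) :
    Ham.triple Ω (Ham.bracketLinear Ω (Ham.bracket Ω (n + 3) x)) +
    (∑ i : Fin (n + 3), ∑ j : Fin (n + 2), if i ≤ j.castSucc then (-1 : ℝ) ^ (i + j : ℕ) •
      Ham.bracketAlternating Ω (n + 2) (Fin.cons ⁅(x i).field, (x (i.succAbove j)).field⁆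
        (j.removeNth (i.removeNth (Ham.field ∘ x))) : Fin (n + 2) → VF E M) else 0) = 0 := by
  have h1 := (zero_add _).trans (bracketField_add_sum n (Ham.field ∘ x))
  have h2 := Ham.dForm_add_sum n x le_rfl
  have h3 := fun p : Fin m => Ham.dForm_add_sum n x p.2.le
  refine add_sum_pairs_eq_zero (L := VF E M) (W := Form E M m) (U := fun p : Fin m => Form E M p)
    (Ham.triple Ω (Ham.bracketLinear Ω (Ham.bracket Ω (n + 3) x)))
    (fun i j => Ham.bracketAlternating Ω (n + 2)
      (Fin.cons ⁅(x i).field, (x (i.succAbove j)).field⁆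
        (j.removeNth (i.removeNth (Ham.field ∘ x))) : Fin (n + 2) → VF E M)) ?_ ?_ ?_
  · exact h1
  · exact h2
  · exact h3

lemma Ham.isFieldBracket (Ω : PrePlectic E M m) : IsFieldBracket (Ham.degree Ω) (Ham.bracket Ω)
    (Ham.fieldLinear Ω) (Ham.triple Ω) (Ham.bracketAlternating Ω) (Ham.bracketLinear Ω) where
  injective := Ham.triple_injective
  apply_bracket := Ham.triple_bracket
  unary _ := rfl
  field_eq_zero _ hd _ hx := Ham.field_eq_zero hx hd
  unary_mem _ _ hx := Ham.bracket₁_mem_degree hx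
  bracket_mem := Ham.bracket_mem_degree
  unary_unary x := Ham.ext_iff'.2 ⟨rfl, x.dForm_bracket₁ m, fun p => x.dForm_bracket₁ p⟩
  unary_binary x := Ham.ext_iff'.2 ⟨rfl, (x 0).dForm_bracket₂ (x 1) m,
    fun p => (x 0).dForm_bracket₂ (x 1) p⟩
  field_unary _ := rfl
  field_binary _ := rfl
  field_bracket _ _ := rfl
  unary_bracket := Ham.triple_add_sum

lemma Ham.projection_mem_reducibleObservables {𝔤 : Type*} [LieRing 𝔤] [LieAlgebra ℝ 𝔤]
    {ρ : 𝔤 →ₗ⁅ℝ⁆ VF E M} {N : Set M} (i : ℤ) {x : Ham Ω} (hx : x ∈ reducibleObservables Ω ρ N) :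
    Ham.projection Ω i x ∈ reducibleObservables Ω ρ N := by
  -- The degree zero component of a projection is either that of `x` or zero; stating this for a
  -- pair `y` treats its field and its form together.
  have h : ∀ y : hamPairs Ω, y = x.1 ∨ y = 0 →
      y.1.1 ∈ reducibleFields ρ N ∧ y.1.2 ∈ reducibleForms ρ N m := by
    rintro y (rfl | rfl)
    · exact ⟨hx.1, hx.2.1⟩
    · exact ⟨zero_mem _, zero_mem _⟩
  have h1 := h (if i = 0 then x.1 else 0) (by split_ifs <;> simp)
  refine ⟨h1.1, h1.2, fun p => ?_⟩
  change (if i = (p : ℤ) - m then x.2 p else 0) ∈ _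
  split_ifs
  · exact hx.2.2 p
  · exact zero_mem _

end Main

end

end Multisymplectic

theorem mainTheorem2 {d : ℕ} {M : Type*} [TopologicalSpace M] [T2Space M] [ParacompactSpace M]
    [ChartedSpace (EuclideanSpace ℝ (Fin d)) M]
    [IsManifold 𝓘(ℝ, EuclideanSpace ℝ (Fin d)) ∞ M]
    {𝔤 : Type*} [LieRing 𝔤] [LieAlgebra ℝ 𝔤]
    (ρ : 𝔤 →ₗ⁅ℝ⁆ Multisymplectic.VF (EuclideanSpace ℝ (Fin d)) M) (N : Set M)
    (hN : Multisymplectic.IsTangentAction ρ N) {m : ℕ}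
    (Ω : Multisymplectic.PrePlectic (EuclideanSpace ℝ (Fin d)) M m)
    (hΩ : Ω.form ∈ Multisymplectic.reducibleForms ρ N (m + 2)) :
    (∀ k, 1 ≤ k → ∀ x : Fin k → Multisymplectic.Ham Ω,
      (∀ i, x i ∈ Multisymplectic.reducibleObservables Ω ρ N) →
        Multisymplectic.Ham.bracket Ω k x ∈ Multisymplectic.reducibleObservables Ω ρ N) ∧
    Multisymplectic.IsLInftySubalgebra (Multisymplectic.Ham.degree Ω)
      (Multisymplectic.Ham.bracket Ω) (Multisymplectic.reducibleObservables Ω ρ N) := by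
  have hl : ∀ k, 1 ≤ k → ∀ x : Fin k → Multisymplectic.Ham Ω,
      (∀ i, x i ∈ Multisymplectic.reducibleObservables Ω ρ N) →
        Multisymplectic.Ham.bracket Ω k x ∈ Multisymplectic.reducibleObservables Ω ρ N :=
    fun k _ _ hx => Multisymplectic.bracket_mem_reducibleObservables hΩ k hx
  exact ⟨hl, (Multisymplectic.Ham.isFieldBracket Ω).isLInftySubalgebra
    (Multisymplectic.Ham.isGradedProjection Ω)
    (fun i _ hx => Multisymplectic.Ham.projection_mem_reducibleObservables i hx) hl⟩
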